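/- Let $K$ be a field and let $E=(E^0,E^1,s,r)$ be a finite directed graph (finitely many vertices and edges, at least one vertex; loops and multiple edges are allowed). Let $L_K(E)$ be its Leavitt path algebra, i.e. the associative (not necessarily unital) $K$-algebra generated by $\{v\mid v\in E^0\}\cup\{e,e^*\mid e\in E^1\}$ subject to the relations $vw=\delta_{vw}v$ for $v,w\in E^0$; $s(e)e=e=e\,r(e)$ and $r(e)e^*=e^*=e^*s(e)$ for $e\in E^1$; $e^*f=\delta_{ef}\,r(e)$ for $e,f\in E^1$; and $\sum_{e\in s^{-1}(v)}ee^*=v$ for every $v\in E^0$ with $s^{-1}(v)\neq\emptyset$. For a finite-dimensional subspace $W$ generating $L_K(E)$ and $n\ge 1$ let $d_W(n)$ be the dimension of the span of all products of at least one and at most $n$ elements of $W$; such $W$ exist. The algebra has polynomial growth if there are positive integers $m,c$ with $d_W(n)\le c\,(cn)^m$ for all $n\ge1$, and $\operatorname{GKdim} L_K(E):=\limsup_{n\to\infty}\log_n d_W(n)\in[-\infty,\infty]$; the statements below hold for every choice of $W$. A cyclic path is a path $e_1\cdots e_n$ with $n\ge1$, $r(e_i)=s(e_{i+1})$ for $i<n$,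 $r(e_n)=s(e_1)$, and $s(e_1),\dots,s(e_n)$ pairwise distinct; a cycle is a subgraph of $E$ consisting of the edges of a cyclic path and their sources and ranges. A chain of cycles of length $k$ is a sequence $C_1,\dots,C_k$ of pairwise distinct cycles such that for each $i<k$ there is a path (possibly of length $0$) from a vertex of $C_i$ to a vertex of $C_{i+1}$; it has an exit if some edge that is not in $C_k$ has its source in $C_k$. Let $d_1$ be the maximal length of a chain of cycles and $d_2$ the maximal length of a chain of cycles with an exit, a maximum being $0$ if there is no such chain (these maxima exist). Then: (i) $L_K(E)$ has polynomial growth if and only if any two distinct cycles have no common vertex. (ii) If $L_K(E)$ has polynomial growth, then $\operatorname{GKdim} L_K(E)=\max(2d_1-1,\,2d_2)$. -/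

import Mathlib

universe u v w

/-! ## Directed graphs, paths, cycles -/

/-- A directed graph with vertex set `V` and edge set `E`, given by its source and range maps. -/
structure DirectedGraph (V : Type u) (E : Type v) where
  s : E → V
  r : E → V

namespace DirectedGraph

variable {V : Type u} {E : Type v}

/-- `G.IsPath x p y`: the edge list `p = e₁ … eₙ` is a path of `G` with source `x` and range `y`.
The empty list is the path of length `0` at a vertex. -/
inductive IsPath (G : DirectedGraph V E) : V → List E → V → Prop
  | nil (x : V) : IsPath G x [] x
  | cons (e : E) {p : List E} {y : V} (h : IsPath G (G.r e) p y) : IsPath G (G.s e) (e :: p) y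

/-- A cyclic path: a path `e₁ … eₙ` with `n ≠ 0` whose source and range agree and such that
the sources `s(e₁), …, s(eₙ)` are pairwise distinct. -/
def IsCyclicPath (G : DirectedGraph V E) (p : List E) : Prop :=
  p ≠ [] ∧ (∃ x, G.IsPath x p x) ∧ (p.map G.s).Nodup

/-- A subgraph: a set of vertices and a set of edges that contains with each edge its source and
range. -/
@[ext]
structure Subgraph (G : DirectedGraph V E) where
  verts : Set V
  edges : Set E
  s_mem : ∀ e ∈ edges, G.s e ∈ verts
  r_mem : ∀ e ∈ edges, G.r e ∈ verts

/-- The subgraph that consists of the edges of `p` and their sources and ranges. -/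
def subgraphOf (G : DirectedGraph V E) (p : List E) : G.Subgraph where
  verts := {x | ∃ e ∈ p, x = G.s e ∨ x = G.r e}
  edges := {e | e ∈ p}
  s_mem := fun e he => ⟨e, he, Or.inl rfl⟩
  r_mem := fun e he => ⟨e, he, Or.inr rfl⟩

variable {G : DirectedGraph V E}

namespace Subgraph

/-- A cycle is the subgraph defined by a cyclic path. -/
def IsCycle (C : G.Subgraph) : Prop :=
  ∃ p, G.IsCyclicPath p ∧ C = G.subgraphOf p

/-- `C.Reaches D`: there is a path that starts at a vertex of `C` and ends at a vertex of `D`. -/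
def Reaches (C D : G.Subgraph) : Prop :=
  ∃ x ∈ C.verts, ∃ y ∈ D.verts, ∃ p, G.IsPath x p y

/-- There is an edge outside `C` that starts at a vertex of `C`. -/
def HasExit (C : G.Subgraph) : Prop :=
  ∃ e, G.s e ∈ C.verts ∧ e ∉ C.edges

end Subgraph

/-- A chain of cycles: a sequence `C₁, …, Cₖ` of pairwise distinct cycles such that there is a path
from each `Cᵢ` to `Cᵢ₊₁`. Its length is `k`; the empty sequence is the chain of length `0`. -/
def IsCycleChain (l : List G.Subgraph) : Prop :=
  (∀ C ∈ l, C.IsCycle) ∧ l.Nodup ∧ l.IsChain Subgraph.Reaches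

/-- A chain has an exit if its last cycle has one. The empty chain counts as having an exit, so that
the maximal length of a chain with an exit is `0` if no cycle has an exit. -/
def ChainHasExit (l : List G.Subgraph) : Prop :=
  ∀ C ∈ l.getLast?, C.HasExit

/-- `d` is the maximal length of a chain of cycles. -/
def IsMaxChainLength (G : DirectedGraph V E) (d : ℕ) : Prop :=
  IsGreatest {k | ∃ l : List G.Subgraph, IsCycleChain l ∧ l.length = k} d

/-- `d` is the maximal length of a chain of cycles with an exit. -/
def IsMaxChainWithExitLength (G : DirectedGraph V E) (d : ℕ) : Prop :=
  IsGreatest {k | ∃ l : List G.Subgraph, IsCycleChain l ∧ ChainHasExit l ∧ l.length = k} d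

end DirectedGraph

/-! ## Leavitt path algebras -/

namespace LeavittPath

/-- The generators: vertices, real edges `e` and ghost edges `e*`. -/
inductive Gen (V : Type u) (E : Type v) : Type (max u v)
  | vertex (x : V)
  | edge (e : E)
  | ghost (e : E)

/-- The free associative, not necessarily unital, `K`-algebra on the generators: its basis is the
set of nonempty words. -/
abbrev FreeAlg (K : Type w) [Field K] (V : Type u) (E : Type v) : Type (max u v w) :=
  MonoidAlgebra K (FreeSemigroup (Gen V E))

section

variable (K : Type w) [Field K] {V : Type u} {E : Type v}

/-- A generator as an element of the free algebra. -/
noncomputable def gen (g : Gen V E) : FreeAlg K V E :=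
  MonoidAlgebra.single (FreeSemigroup.of g) 1

open Gen in
/-- The defining relations of the Leavitt path algebra. -/
inductive Rel (G : DirectedGraph V E) : FreeAlg K V E → FreeAlg K V E → Prop
  | vertex_mul_self (x : V) : Rel G (gen K (vertex x) * gen K (vertex x)) (gen K (vertex x))
  | vertex_mul_of_ne (x y : V) (h : x ≠ y) : Rel G (gen K (vertex x) * gen K (vertex y)) 0
  | source_mul_edge (e : E) : Rel G (gen K (vertex (G.s e)) * gen K (edge e)) (gen K (edge e))
  | edge_mul_range (e : E) : Rel G (gen K (edge e) * gen K (vertex (G.r e))) (gen K (edge e))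
  | range_mul_ghost (e : E) : Rel G (gen K (vertex (G.r e)) * gen K (ghost e)) (gen K (ghost e))
  | ghost_mul_source (e : E) : Rel G (gen K (ghost e) * gen K (vertex (G.s e))) (gen K (ghost e))
  | ghost_mul_self (e : E) : Rel G (gen K (ghost e) * gen K (edge e)) (gen K (vertex (G.r e)))
  | ghost_mul_of_ne (e f : E) (h : e ≠ f) : Rel G (gen K (ghost e) * gen K (edge f)) 0
  | sum_edge_mul_ghost (x : V) (hfin : {e | G.s e = x}.Finite) (hne : {e | G.s e = x}.Nonempty) :
      Rel G (∑ e ∈ hfin.toFinset, gen K (edge e) * gen K (ghost e)) (gen K (vertex x))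

/-- The scalar multiples of the defining relations. They are needed to generate a `K`-linear ideal,
since the free algebra has no unit. -/
def SMulRel (G : DirectedGraph V E) (a b : FreeAlg K V E) : Prop :=
  ∃ (k : K) (a' b' : FreeAlg K V E), Rel K G a' b' ∧ a = k • a' ∧ b = k • b'

/-- The smallest `K`-algebra congruence that contains the defining relations. -/
noncomputable def con (G : DirectedGraph V E) : RingCon (FreeAlg K V E) :=
  ringConGen (SMulRel K G)

theorem con_smul (G : DirectedGraph V E) (k : K) {a b : FreeAlg K V E} (h : con K G a b) :
    con K G (k • a) (k • b) := by
  change RingConGen.Rel (SMulRel K G) a b at h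
  change RingConGen.Rel (SMulRel K G) (k • a) (k • b)
  induction h with
  | of x y h =>
    obtain ⟨c, x', y', h, rfl, rfl⟩ := h
    exact .of _ _ ⟨k * c, x', y', h, (mul_smul k c x').symm, (mul_smul k c y').symm⟩
  | refl x => exact .refl _
  | symm _ ih => exact ih.symm
  | trans _ _ ih₁ ih₂ => exact ih₁.trans ih₂
  | add _ _ ih₁ ih₂ => rw [smul_add, smul_add]; exact ih₁.add ih₂
  | mul _ h₂ ih₁ _ => rw [← smul_mul_assoc, ← smul_mul_assoc]; exact ih₁.mul h₂

end

end LeavittPath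

/-- The Leavitt path algebra `L_K(G)`: the free associative algebra on the vertices, edges and ghost
edges modulo the defining relations. -/
def LeavittPathAlgebra (K : Type w) [Field K] {V : Type u} {E : Type v} (G : DirectedGraph V E) :
    Type (max u v w) :=
  (LeavittPath.con K G).Quotient

namespace LeavittPathAlgebra

variable (K : Type w) [Field K] {V : Type u} {E : Type v} (G : DirectedGraph V E)

noncomputable instance : NonUnitalRing (LeavittPathAlgebra K G) :=
  inferInstanceAs (NonUnitalRing (LeavittPath.con K G).Quotient)

/-- The quotient map from the free algebra. -/
noncomputable def mk (a : LeavittPath.FreeAlg K V E) : LeavittPathAlgebra K G :=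
  RingCon.toQuotient a

noncomputable instance : SMul K (LeavittPathAlgebra K G) where
  smul k := Quotient.map' (fun a => k • a) fun _ _ h => LeavittPath.con_smul K G k h

noncomputable instance : Module K (LeavittPathAlgebra K G) where
  one_smul := Quotient.ind' fun a => congrArg (mk K G) (one_smul K a)
  mul_smul k l := Quotient.ind' fun a => congrArg (mk K G) (mul_smul k l a)
  smul_zero k := congrArg (mk K G) (smul_zero k)
  smul_add k := Quotient.ind₂' fun a b => congrArg (mk K G) (smul_add k a b)
  add_smul k l := Quotient.ind' fun a => congrArg (mk K G) (add_smul k l a)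
  zero_smul := Quotient.ind' fun a => congrArg (mk K G) (zero_smul K a)

instance : IsScalarTower K (LeavittPathAlgebra K G) (LeavittPathAlgebra K G) where
  smul_assoc k := Quotient.ind₂' fun a b => congrArg (mk K G) (smul_mul_assoc k a b)

instance : SMulCommClass K (LeavittPathAlgebra K G) (LeavittPathAlgebra K G) where
  smul_comm k := Quotient.ind₂' fun a b => congrArg (mk K G) (mul_smul_comm k a b).symm

end LeavittPathAlgebra

/-! ## Growth of algebras -/

namespace Growth

/-- `IsProd S k a`: `a` is a product `v₁ ⋯ vₖ` of `k ≥ 1` elements of `S`. -/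
inductive IsProd {A : Type u} [Mul A] (S : Set A) : ℕ → A → Prop
  | of {a : A} (h : a ∈ S) : IsProd S 1 a
  | mul {a b : A} {k : ℕ} (ha : a ∈ S) (hb : IsProd S k b) : IsProd S (k + 1) (a * b)

/-- `f ≼ g` for functions on the positive integers. -/
def AsympLE (f g : ℕ → ℝ) : Prop :=
  ∃ c : ℕ, 0 < c ∧ ∀ n : ℕ, 0 < n → f n ≤ c * g (c * n)

variable {K : Type v} [Field K] {A : Type u} [NonUnitalRing A] [Module K A]

/-- `W` is a finite-dimensional subspace that generates the (not necessarily unital) algebra `A`. -/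
def IsGeneratingSpace [IsScalarTower K A A] [SMulCommClass K A A] (W : Submodule K A) : Prop :=
  FiniteDimensional K W ∧ NonUnitalAlgebra.adjoin K (W : Set A) = ⊤

/-- `Wⁿ`, the span of all products of at least one and at most `n` elements of `W`. -/
def powSpan (W : Submodule K A) (n : ℕ) : Submodule K A :=
  Submodule.span K {a | ∃ k ≤ n, IsProd (W : Set A) k a}

/-- `d_W(n) = dim Wⁿ`. -/
noncomputable def growthFun (W : Submodule K A) (n : ℕ) : ℕ :=
  Module.finrank K (powSpan W n)

/-- Polynomial growth, tested on the generating space `W`: `d_W ≼ n^m` for some `m ≥ 1`. -/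
def HasPolynomialGrowth (W : Submodule K A) : Prop :=
  ∃ m : ℕ, 0 < m ∧ AsympLE (fun n => (growthFun W n : ℝ)) (fun n => (n : ℝ) ^ m)

/-- The Gelfand-Kirillov dimension, computed on the generating space `W`:
`limsup log_n d_W(n)` as an extended real number. -/
noncomputable def gkDim (W : Submodule K A) : EReal :=
  Filter.limsup (fun n : ℕ => ((Real.logb n (growthFun W n) : ℝ) : EReal)) Filter.atTop

end Growth

/-!
The monomials `e₁ ⋯ eₙ x f₁* ⋯ fₘ*`, where `e₁ ⋯ eₙ` and `fₘ ⋯ f₁` are paths that end at `x`, span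
`L_K(G)`. At each vertex that emits finitely many edges, and at least one, choose an edge and call
it special. The relation `∑ e e* = v` expresses `e e*` for special `e` through the other edges, so
the monomials with `eₙ ≠ f₁` or `eₙ` not special still span. They are a basis, because the rewriting
rules define operators on the free module over them that satisfy the defining relations. Hence, for
the span `W` of the generators, `d_W(n)` is the number of normal monomials of length at most `n`.

If the cycles are disjoint, a path runs through a chain of cycles, and its number of rounds in each
cycle is free. If at most `k` cycles can be met on the way to `x`, there are `O(n ^ k)` paths of
length at most `n` that end at `x`, hence `O(n ^ (2k))` pairs of such paths. If `x` is on a cycle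
without exit, then all edges of this cycle are special, so two paths that form a normal monomial
cannot both run through it, and one factor `n` is lost. Both bounds are attained by monomials built
from a chain of cycles of maximal length. Two different cycles with a common vertex, however, give
`2 ^ n` paths of length `O(n)`.
-/

/-! ## Paths -/

namespace DirectedGraph

variable {V : Type u} {E : Type v} {G : DirectedGraph V E} {e : E} {p q : List E} {x y z : V}

theorem isPath_nil_iff : G.IsPath y [] x ↔ y = x :=
  ⟨fun h => by cases h; rfl, fun h => h ▸ .nil y⟩

theorem isPath_cons_iff : G.IsPath y (e :: p) x ↔ G.s e = y ∧ G.IsPath (G.r e) p x :=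
  ⟨fun h => by cases h with | cons _ h => exact ⟨rfl, h⟩, fun ⟨hy, h⟩ => hy ▸ .cons e h⟩

theorem isPath_append_iff :
    G.IsPath y (p ++ q) x ↔ ∃ z, G.IsPath y p z ∧ G.IsPath z q x := by
  induction p generalizing y with
  | nil => simp [isPath_nil_iff]
  | cons e p ih => simp [isPath_cons_iff, ih, and_assoc]

theorem isPath_singleton_iff : G.IsPath y [e] x ↔ G.s e = y ∧ G.r e = x := by
  rw [isPath_cons_iff, isPath_nil_iff]

theorem isPath_singleton (e : E) : G.IsPath (G.s e) [e] (G.r e) := .cons e (.nil _)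

theorem IsPath.append (hp : G.IsPath x p y) (hq : G.IsPath y q z) : G.IsPath x (p ++ q) z :=
  isPath_append_iff.2 ⟨y, hp, hq⟩

theorem IsPath.source_unique (hp : G.IsPath x p z) (hq : G.IsPath y p z) : x = y := by
  cases p with
  | nil => rw [isPath_nil_iff.1 hp, isPath_nil_iff.1 hq]
  | cons e p => rw [← (isPath_cons_iff.1 hp).1, (isPath_cons_iff.1 hq).1]

theorem IsPath.range_unique (hp : G.IsPath x p y) (hq : G.IsPath x p z) : y = z := by
  induction hp with
  | nil => exact isPath_nil_iff.1 hq
  | cons e _ ih => exact ih (isPath_cons_iff.1 hq).2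

variable (G) in
/-- The edge list `p` is a path with range `x`, from an unspecified source. -/
def IsPathTo (p : List E) (x : V) : Prop := ∃ y, G.IsPath y p x

theorem isPathTo_nil : G.IsPathTo [] x := ⟨x, .nil x⟩

theorem isPathTo_cons_iff : G.IsPathTo (e :: p) x ↔ G.IsPath (G.r e) p x := by
  simp [IsPathTo, isPath_cons_iff]

theorem isPathTo_append_singleton_iff :
    G.IsPathTo (p ++ [e]) x ↔ G.r e = x ∧ G.IsPathTo p (G.s e) := by
  simp only [IsPathTo, isPath_append_iff, isPath_singleton_iff]
  aesop

theorem IsPath.isPathTo (h : G.IsPath y p x) : G.IsPathTo p x := ⟨y, h⟩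

theorem IsPathTo.append (hp : G.IsPathTo p y) (hq : G.IsPath y q x) : G.IsPathTo (p ++ q) x :=
  let ⟨_, h⟩ := hp
  (h.append hq).isPathTo

end DirectedGraph

/-! ## Normal monomials -/

namespace DirectedGraph

variable {V : Type u} {E : Type v}

section Special

variable (G : DirectedGraph V E)

/-- `e` is the edge chosen among the edges with source `s(e)`. A choice is made only at the
vertices that emit finitely many edges, as these are the ones with a relation `∑ e e* = v`. -/
structure IsSpecial (e : E) : Prop where
  finite : {f | G.s f = G.s e}.Finite
  eq_out : (Quotient.mk (Setoid.ker G.s) e).out = e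

open Classical in
/-- The other edges with the same source as `e`, if there are finitely many, and `∅` otherwise. -/
noncomputable def siblings (e : E) : Finset E :=
  if h : {f | G.s f = G.s e}.Finite then h.toFinset.erase e else ∅

variable {G} {e f : E}

theorem IsSpecial.eq (he : G.IsSpecial e) (hf : G.IsSpecial f) (h : G.s e = G.s f) : e = f := by
  rw [← he.eq_out, ← hf.eq_out]
  exact congrArg Quotient.out (Quotient.sound (s := Setoid.ker G.s) h)

theorem exists_isSpecial {x : V} (hfin : {e | G.s e = x}.Finite)
    (hne : {e | G.s e = x}.Nonempty) : ∃ e, G.s e = x ∧ G.IsSpecial e := by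
  obtain ⟨f, rfl⟩ := hne
  have hs : G.s (Quotient.mk (Setoid.ker G.s) f).out = G.s f :=
    Quotient.mk_out (s := Setoid.ker G.s) f
  refine ⟨_, hs, by rwa [hs], by rw [Quotient.out_eq]⟩

theorem IsSpecial.mem_siblings_iff (he : G.IsSpecial e) :
    f ∈ G.siblings e ↔ f ≠ e ∧ G.s f = G.s e := by
  simp [siblings, he.finite]

theorem IsSpecial.not_isSpecial_of_mem_siblings (he : G.IsSpecial e) (hf : f ∈ G.siblings e) :
    ¬ G.IsSpecial f := fun h =>
  let ⟨hne, hs⟩ := he.mem_siblings_iff.1 hf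
  hne (h.eq he hs)

theorem IsSpecial.sum_eq_add_sum_siblings {M : Type*} [AddCommMonoid M] (he : G.IsSpecial e)
    (F : E → M) : ∑ f ∈ he.finite.toFinset, F f = F e + ∑ f ∈ G.siblings e, F f := by
  classical
  rw [siblings, dif_pos he.finite, Finset.add_sum_erase]
  simp

end Special

/-- The data `e₁ ⋯ eₙ`, `x`, `f₁ ⋯ fₘ` of a monomial `e₁ ⋯ eₙ x f₁* ⋯ fₘ*`. -/
structure Monomial (V : Type u) (E : Type v) where
  real : List E
  range : V
  ghost : List E

/-- The number of edges and ghost edges of a monomial. -/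
def Monomial.length (m : Monomial V E) : ℕ := m.real.length + m.ghost.length

section IsNormal

variable (G : DirectedGraph V E)

/-- The monomial `m = e₁ ⋯ eₙ x f₁* ⋯ fₘ*` consists of two paths `e₁ ⋯ eₙ` and `fₘ ⋯ f₁` with
range `x`, and is not of the form `⋯ e e* ⋯` with a special edge `e`. -/
structure IsNormal (m : Monomial V E) : Prop where
  real : G.IsPathTo m.real m.range
  ghost : G.IsPathTo m.ghost.reverse m.range
  not_isSpecial : ∀ e, m.real.getLast? = some e → m.ghost.head? = some e → ¬ G.IsSpecial e

variable {G} {x : V} {e : E} {p q : List E}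

theorem isNormal_nil_iff : G.IsNormal ⟨[], x, q⟩ ↔ G.IsPathTo q.reverse x :=
  ⟨fun h => h.ghost, fun h => ⟨isPathTo_nil, h, by simp⟩⟩

theorem isNormal_nil_cons_iff :
    G.IsNormal ⟨[], x, e :: q⟩ ↔ G.r e = x ∧ G.IsNormal ⟨[], G.s e, q⟩ := by
  simp [isNormal_nil_iff, isPathTo_append_singleton_iff]

theorem IsNormal.isPath (h : G.IsNormal ⟨e :: p, x, q⟩) : G.IsPath (G.r e) p x :=
  isPathTo_cons_iff.1 h.real

theorem IsNormal.of_cons (h : G.IsNormal ⟨e :: p, x, q⟩) : G.IsNormal ⟨p, x, q⟩ := by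
  refine ⟨h.isPath.isPathTo, h.ghost, fun f hf => h.not_isSpecial f ?_⟩
  cases p with
  | nil => simp at hf
  | cons => rwa [List.getLast?_cons_cons]

theorem IsNormal.sibling {f : E} (h : G.IsNormal ⟨[], G.r e, e :: q⟩) (he : G.IsSpecial e)
    (hf : f ∈ G.siblings e) : G.IsNormal ⟨[f], G.r f, f :: q⟩ := by
  refine ⟨(isPath_singleton f).isPathTo, ?_, fun g hg _ => ?_⟩
  · rw [isNormal_nil_cons_iff, isNormal_nil_iff] at h
    simpa [isPathTo_append_singleton_iff, (he.mem_siblings_iff.1 hf).2] using h.2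
  · obtain rfl : f = g := by simpa using hg
    exact he.not_isSpecial_of_mem_siblings hf

theorem IsNormal.cons_cases (h : G.IsNormal ⟨p, x, q⟩) (e : E) :
    ¬ G.IsPath (G.r e) p x ∨ G.IsNormal ⟨e :: p, x, q⟩ ∨
      ∃ q', p = [] ∧ x = G.r e ∧ q = e :: q' ∧ G.IsSpecial e := by
  by_cases hp : G.IsPath (G.r e) p x
  case neg => exact .inl hp
  by_cases hs : p = [] ∧ q.head? = some e ∧ G.IsSpecial e
  · obtain ⟨rfl, hq, he⟩ := hs
    obtain ⟨q', rfl⟩ := List.head?_eq_some_iff.1 hq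
    exact .inr (.inr ⟨q', rfl, (isPath_nil_iff.1 hp).symm, rfl, he⟩)
  refine .inr (.inl ⟨isPathTo_cons_iff.2 hp, h.ghost, fun f hf hq => ?_⟩)
  cases p with
  | nil =>
    obtain rfl : e = f := by simpa using hf
    exact fun he => hs ⟨rfl, hq, he⟩
  | cons => exact h.not_isSpecial f (by simpa only [List.getLast?_cons_cons] using hf) hq

end IsNormal

end DirectedGraph

/-! ## The operators of the generators -/

namespace LeavittPath

open DirectedGraph Gen

section Operators

variable (K : Type w) [Field K] {V : Type u} {E : Type v} (G : DirectedGraph V E)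

/-- The space with basis the normal monomials, on which the generators will act as they do on the
Leavitt path algebra by left multiplication. -/
abbrev NormalSpace : Type max u v w := {m : Monomial V E // G.IsNormal m} →₀ K

open Classical in
/-- The basis vector of a normal monomial, and `0` for any other monomial. -/
noncomputable def normalSingle (m : Monomial V E) : NormalSpace K G :=
  if h : G.IsNormal m then .single ⟨m, h⟩ 1 else 0

open Classical in
/-- The product of a generator and a normal monomial in terms of normal monomials. The product of
`e` and `r(e) e* q*` with `e` special is rewritten by `e e* = s(e) - ∑ f f*`, where `f` runs over
the siblings of `e`. -/
noncomputable def genAct : Gen V E → Monomial V E → NormalSpace K G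
  | vertex y, m => if G.IsPath y m.real m.range then normalSingle K G m else 0
  | edge e, ⟨p, x, q⟩ =>
    if p = [] ∧ q.head? = some e ∧ G.IsSpecial e then
      normalSingle K G ⟨[], G.s e, q.tail⟩ -
        ∑ f ∈ G.siblings e, normalSingle K G ⟨[f], G.r f, f :: q.tail⟩
    else normalSingle K G ⟨e :: p, x, q⟩
  | ghost e, ⟨[], x, q⟩ => if G.s e = x then normalSingle K G ⟨[], G.r e, e :: q⟩ else 0
  | ghost e, ⟨f :: p, x, q⟩ => if f = e then normalSingle K G ⟨p, x, q⟩ else 0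

/-- The operator by which a generator acts on the space with basis the normal monomials. -/
noncomputable def genOp (g : Gen V E) : Module.End K (NormalSpace K G) :=
  Finsupp.linearCombination K fun m => genAct K G g m.1

variable {K G} {m : Monomial V E} {e f : E} {p q : List E} {x y : V}

theorem normalSingle_of_isNormal (h : G.IsNormal m) : normalSingle K G m = .single ⟨m, h⟩ 1 :=
  dif_pos h

theorem normalSingle_of_not_isNormal (h : ¬ G.IsNormal m) : normalSingle K G m = 0 := dif_neg h

theorem end_ext {φ ψ : Module.End K (NormalSpace K G)}
    (h : ∀ m, G.IsNormal m → φ (normalSingle K G m) = ψ (normalSingle K G m)) : φ = ψ :=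
  Finsupp.lhom_ext' fun m => LinearMap.ext_ring <| by
    have hm := h m.1 m.2
    rwa [normalSingle_of_isNormal m.2] at hm

theorem genOp_normalSingle (g : Gen V E) (h : G.IsNormal m) :
    genOp K G g (normalSingle K G m) = genAct K G g m := by
  rw [normalSingle_of_isNormal h, genOp, Finsupp.linearCombination_single, one_smul]

theorem genOp_vertex (h : G.IsPath y p x) :
    genOp K G (vertex y) (normalSingle K G ⟨p, x, q⟩) = normalSingle K G ⟨p, x, q⟩ := by
  by_cases hm : G.IsNormal ⟨p, x, q⟩
  · simp [genOp_normalSingle _ hm, genAct, h]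
  · simp [normalSingle_of_not_isNormal hm]

theorem genOp_vertex_of_not_isPath (h : ¬ G.IsPath y p x) :
    genOp K G (vertex y) (normalSingle K G ⟨p, x, q⟩) = 0 := by
  by_cases hm : G.IsNormal ⟨p, x, q⟩
  · simp [genOp_normalSingle _ hm, genAct, h]
  · simp [normalSingle_of_not_isNormal hm]

theorem genOp_edge (h : G.IsNormal ⟨e :: p, x, q⟩) :
    genOp K G (edge e) (normalSingle K G ⟨p, x, q⟩) = normalSingle K G ⟨e :: p, x, q⟩ := by
  rw [genOp_normalSingle _ h.of_cons, genAct, if_neg]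
  rintro ⟨rfl, hq, he⟩
  exact h.not_isSpecial e rfl hq he

theorem genOp_edge_of_not_isPath (h : ¬ G.IsPath (G.r e) p x) :
    genOp K G (edge e) (normalSingle K G ⟨p, x, q⟩) = 0 := by
  by_cases hm : G.IsNormal ⟨p, x, q⟩
  case neg => rw [normalSingle_of_not_isNormal hm, map_zero]
  rw [genOp_normalSingle _ hm, genAct, if_neg, normalSingle_of_not_isNormal fun h' => h h'.isPath]
  rintro ⟨rfl, hq, -⟩
  obtain ⟨q, rfl⟩ := List.head?_eq_some_iff.1 hq
  exact h (isPath_nil_iff.2 (isNormal_nil_cons_iff.1 hm).1)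

theorem genOp_edge_of_isSpecial (he : G.IsSpecial e) (h : G.IsNormal ⟨[], G.r e, e :: q⟩) :
    genOp K G (edge e) (normalSingle K G ⟨[], G.r e, e :: q⟩) = normalSingle K G ⟨[], G.s e, q⟩ -
      ∑ f ∈ G.siblings e, normalSingle K G ⟨[f], G.r f, f :: q⟩ := by
  rw [genOp_normalSingle _ h, genAct, if_pos ⟨rfl, rfl, he⟩, List.tail_cons]

theorem genOp_ghost_nil (e : E) (q : List E) :
    genOp K G (ghost e) (normalSingle K G ⟨[], G.s e, q⟩) =
      normalSingle K G ⟨[], G.r e, e :: q⟩ := by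
  by_cases hm : G.IsNormal ⟨[], G.s e, q⟩
  · rw [genOp_normalSingle _ hm, genAct, if_pos rfl]
  · rw [normalSingle_of_not_isNormal hm, map_zero, normalSingle_of_not_isNormal]
    exact fun h => hm (isNormal_nil_cons_iff.1 h).2

theorem genOp_ghost_nil_of_ne (h : G.s e ≠ x) :
    genOp K G (ghost e) (normalSingle K G ⟨[], x, q⟩) = 0 := by
  by_cases hm : G.IsNormal ⟨[], x, q⟩
  · rw [genOp_normalSingle _ hm, genAct, if_neg h]
  · rw [normalSingle_of_not_isNormal hm, map_zero]

theorem genOp_ghost_cons (h : G.IsNormal ⟨e :: p, x, q⟩) :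
    genOp K G (ghost e) (normalSingle K G ⟨e :: p, x, q⟩) = normalSingle K G ⟨p, x, q⟩ := by
  rw [genOp_normalSingle _ h, genAct, if_pos rfl]

theorem genOp_ghost_cons_of_ne (h : f ≠ e) :
    genOp K G (ghost e) (normalSingle K G ⟨f :: p, x, q⟩) = 0 := by
  by_cases hm : G.IsNormal ⟨f :: p, x, q⟩
  · rw [genOp_normalSingle _ hm, genAct, if_neg h]
  · rw [normalSingle_of_not_isNormal hm, map_zero]

end Operators

/-! ## The defining relations for the operators -/

section Relations

variable (K : Type w) [Field K] {V : Type u} {E : Type v} (G : DirectedGraph V E)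

theorem genOp_vertex_mul_self (x : V) :
    genOp K G (vertex x) * genOp K G (vertex x) = genOp K G (vertex x) := by
  refine end_ext fun ⟨p, z, q⟩ _ => ?_
  rw [Module.End.mul_apply]
  by_cases hp : G.IsPath x p z
  · simp only [genOp_vertex hp]
  · simp only [genOp_vertex_of_not_isPath hp, map_zero]

theorem genOp_vertex_mul_of_ne {x y : V} (h : x ≠ y) :
    genOp K G (vertex x) * genOp K G (vertex y) = 0 := by
  refine end_ext fun ⟨p, z, q⟩ _ => ?_
  rw [Module.End.mul_apply, LinearMap.zero_apply]
  by_cases hp : G.IsPath y p z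
  · rw [genOp_vertex hp, genOp_vertex_of_not_isPath fun hx => h (hx.source_unique hp)]
  · rw [genOp_vertex_of_not_isPath hp, map_zero]

theorem genOp_source_mul_edge (e : E) :
    genOp K G (vertex (G.s e)) * genOp K G (edge e) = genOp K G (edge e) := by
  refine end_ext fun ⟨p, x, q⟩ hm => ?_
  rw [Module.End.mul_apply]
  obtain hp | h | ⟨q, rfl, rfl, rfl, he⟩ := hm.cons_cases e
  · rw [genOp_edge_of_not_isPath hp, map_zero]
  · rw [genOp_edge h, genOp_vertex (isPath_cons_iff.2 ⟨rfl, h.isPath⟩)]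
  · have hsibling : ∀ f ∈ G.siblings e, G.IsPath (G.s e) [f] (G.r f) := fun f hf =>
      isPath_singleton_iff.2 ⟨(he.mem_siblings_iff.1 hf).2, rfl⟩
    rw [genOp_edge_of_isSpecial he hm, map_sub, map_sum, genOp_vertex (.nil _),
      Finset.sum_congr rfl fun f hf => genOp_vertex (hsibling f hf)]

theorem genOp_edge_mul_range (e : E) :
    genOp K G (edge e) * genOp K G (vertex (G.r e)) = genOp K G (edge e) := by
  refine end_ext fun ⟨p, x, q⟩ _ => ?_
  rw [Module.End.mul_apply]
  by_cases hp : G.IsPath (G.r e) p x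
  · rw [genOp_vertex hp]
  · rw [genOp_vertex_of_not_isPath hp, map_zero, genOp_edge_of_not_isPath hp]

theorem genOp_range_mul_ghost (e : E) :
    genOp K G (vertex (G.r e)) * genOp K G (ghost e) = genOp K G (ghost e) := by
  refine end_ext fun ⟨p, x, q⟩ hm => ?_
  rw [Module.End.mul_apply]
  cases p with
  | nil =>
    by_cases hx : G.s e = x
    · rw [← hx, genOp_ghost_nil, genOp_vertex (.nil _)]
    · rw [genOp_ghost_nil_of_ne hx, map_zero]
  | cons f p =>
    by_cases hf : f = e
    · subst hf
      rw [genOp_ghost_cons hm, genOp_vertex hm.isPath]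
    · rw [genOp_ghost_cons_of_ne hf, map_zero]

theorem genOp_ghost_mul_source (e : E) :
    genOp K G (ghost e) * genOp K G (vertex (G.s e)) = genOp K G (ghost e) := by
  refine end_ext fun ⟨p, x, q⟩ _ => ?_
  rw [Module.End.mul_apply]
  by_cases hp : G.IsPath (G.s e) p x
  · rw [genOp_vertex hp]
  rw [genOp_vertex_of_not_isPath hp, map_zero]
  cases p with
  | nil => rw [genOp_ghost_nil_of_ne fun h => hp (isPath_nil_iff.2 h)]
  | cons f p =>
    by_cases hf : f = e
    · rw [normalSingle_of_not_isNormal, map_zero]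
      exact fun h => hp (isPath_cons_iff.2 ⟨congrArg G.s hf, h.isPath⟩)
    · rw [genOp_ghost_cons_of_ne hf]

theorem genOp_ghost_mul_self (e : E) :
    genOp K G (ghost e) * genOp K G (edge e) = genOp K G (vertex (G.r e)) := by
  refine end_ext fun ⟨p, x, q⟩ hm => ?_
  rw [Module.End.mul_apply]
  obtain hp | h | ⟨q, rfl, rfl, rfl, he⟩ := hm.cons_cases e
  · rw [genOp_edge_of_not_isPath hp, map_zero, genOp_vertex_of_not_isPath hp]
  · rw [genOp_edge h, genOp_ghost_cons h, genOp_vertex h.isPath]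
  · rw [genOp_edge_of_isSpecial he hm, map_sub, map_sum, genOp_ghost_nil, genOp_vertex (.nil _),
      Finset.sum_eq_zero, sub_zero]
    exact fun f hf => genOp_ghost_cons_of_ne (he.mem_siblings_iff.1 hf).1

theorem genOp_ghost_mul_of_ne {e f : E} (hef : e ≠ f) :
    genOp K G (ghost e) * genOp K G (edge f) = 0 := by
  refine end_ext fun ⟨p, x, q⟩ hm => ?_
  rw [Module.End.mul_apply, LinearMap.zero_apply]
  obtain hp | h | ⟨q, rfl, rfl, rfl, hf⟩ := hm.cons_cases f
  · rw [genOp_edge_of_not_isPath hp, map_zero]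
  · rw [genOp_edge h, genOp_ghost_cons_of_ne hef.symm]
  rw [genOp_edge_of_isSpecial hf hm, map_sub, map_sum, sub_eq_zero]
  by_cases hs : G.s e = G.s f
  · have he : e ∈ G.siblings f := hf.mem_siblings_iff.2 ⟨hef, hs⟩
    rw [Finset.sum_eq_single_of_mem e he fun g _ => genOp_ghost_cons_of_ne,
      genOp_ghost_cons (hm.sibling hf he), ← hs, genOp_ghost_nil]
  · rw [genOp_ghost_nil_of_ne hs, Finset.sum_eq_zero]
    rintro g hg
    exact genOp_ghost_cons_of_ne fun hge => hs (hge ▸ (hf.mem_siblings_iff.1 hg).2)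

theorem genOp_edge_mul_ghost_nil {e : E} {q : List E} (he : G.IsSpecial e)
    (hm : G.IsNormal ⟨[], G.s e, q⟩) :
    (genOp K G (edge e) * genOp K G (ghost e)) (normalSingle K G ⟨[], G.s e, q⟩) =
      normalSingle K G ⟨[], G.s e, q⟩ - ∑ f ∈ G.siblings e,
        (genOp K G (edge f) * genOp K G (ghost f)) (normalSingle K G ⟨[], G.s e, q⟩) := by
  have hm' : G.IsNormal ⟨[], G.r e, e :: q⟩ := isNormal_nil_cons_iff.2 ⟨rfl, hm⟩
  rw [Module.End.mul_apply, genOp_ghost_nil, genOp_edge_of_isSpecial he hm']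
  congr 1
  refine Finset.sum_congr rfl fun f hf => ?_
  rw [Module.End.mul_apply, ← (he.mem_siblings_iff.1 hf).2, genOp_ghost_nil,
    genOp_edge (hm'.sibling he hf)]

theorem sum_genOp_edge_mul_ghost {x : V} (hfin : {e | G.s e = x}.Finite)
    (hne : {e | G.s e = x}.Nonempty) :
    ∑ e ∈ hfin.toFinset, genOp K G (edge e) * genOp K G (ghost e) = genOp K G (vertex x) := by
  obtain ⟨e, rfl, he⟩ := exists_isSpecial hfin hne
  refine end_ext fun ⟨p, y, q⟩ hm => ?_
  rw [LinearMap.sum_apply]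
  cases p with
  | nil =>
    by_cases hy : G.s e = y
    · subst hy
      rw [he.sum_eq_add_sum_siblings, genOp_edge_mul_ghost_nil K G he hm, sub_add_cancel,
        genOp_vertex (.nil _)]
    · rw [genOp_vertex_of_not_isPath fun h => hy (isPath_nil_iff.1 h)]
      refine Finset.sum_eq_zero fun f hf => ?_
      have hf : G.s f = G.s e := hfin.mem_toFinset.1 hf
      rw [Module.End.mul_apply, genOp_ghost_nil_of_ne (hf ▸ hy), map_zero]
  | cons g p =>
    have hterm : ∀ f, f ≠ g → (genOp K G (edge f) * genOp K G (ghost f))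
        (normalSingle K G ⟨g :: p, y, q⟩) = 0 := fun f hf => by
      rw [Module.End.mul_apply, genOp_ghost_cons_of_ne hf.symm, map_zero]
    by_cases hg : G.s g = G.s e
    · rw [Finset.sum_eq_single_of_mem g (hfin.mem_toFinset.2 hg) fun f _ => hterm f,
        Module.End.mul_apply, genOp_ghost_cons hm, genOp_edge hm,
        genOp_vertex (isPath_cons_iff.2 ⟨hg, hm.isPath⟩)]
    · rw [genOp_vertex_of_not_isPath fun h => hg (isPath_cons_iff.1 h).1]
      refine Finset.sum_eq_zero fun f hf => hterm f ?_
      rintro rfl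
      exact hg (hfin.mem_toFinset.1 hf)

end Relations

end LeavittPath

/-! ## A basis of the Leavitt path algebra -/

namespace LeavittPathAlgebra

open DirectedGraph LeavittPath Gen

variable (K : Type w) [Field K] {V : Type u} {E : Type v} (G : DirectedGraph V E)

/-- The quotient map from the free algebra as a homomorphism. -/
noncomputable def mkHom : FreeAlg K V E →ₙₐ[K] LeavittPathAlgebra K G where
  toFun := mk K G
  map_smul' _ _ := rfl
  map_zero' := rfl
  map_add' _ _ := rfl
  map_mul' _ _ := rfl

theorem mkHom_surjective : Function.Surjective (mkHom K G) := Quotient.mk_surjective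

/-- A vertex, an edge or a ghost edge as an element of the Leavitt path algebra. -/
noncomputable def ofGen (g : Gen V E) : LeavittPathAlgebra K G := mkHom K G (gen K g)

section DefiningRelations

theorem mkHom_eq_of_rel {a b : FreeAlg K V E} (h : Rel K G a b) : mkHom K G a = mkHom K G b :=
  Quotient.sound (.of _ _ ⟨1, a, b, h, (one_smul _ _).symm, (one_smul _ _).symm⟩)

theorem vertex_mul_self (x : V) :
    ofGen K G (vertex x) * ofGen K G (vertex x) = ofGen K G (vertex x) := by
  simpa only [ofGen, map_mul] using mkHom_eq_of_rel K G (.vertex_mul_self x)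

theorem vertex_mul_of_ne {x y : V} (h : x ≠ y) :
    ofGen K G (vertex x) * ofGen K G (vertex y) = 0 := by
  simpa only [ofGen, map_mul, map_zero] using mkHom_eq_of_rel K G (.vertex_mul_of_ne x y h)

theorem source_mul_edge (e : E) :
    ofGen K G (vertex (G.s e)) * ofGen K G (edge e) = ofGen K G (edge e) := by
  simpa only [ofGen, map_mul] using mkHom_eq_of_rel K G (.source_mul_edge e)

theorem edge_mul_range (e : E) :
    ofGen K G (edge e) * ofGen K G (vertex (G.r e)) = ofGen K G (edge e) := by
  simpa only [ofGen, map_mul] using mkHom_eq_of_rel K G (.edge_mul_range e)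

theorem range_mul_ghost (e : E) :
    ofGen K G (vertex (G.r e)) * ofGen K G (ghost e) = ofGen K G (ghost e) := by
  simpa only [ofGen, map_mul] using mkHom_eq_of_rel K G (.range_mul_ghost e)

theorem ghost_mul_source (e : E) :
    ofGen K G (ghost e) * ofGen K G (vertex (G.s e)) = ofGen K G (ghost e) := by
  simpa only [ofGen, map_mul] using mkHom_eq_of_rel K G (.ghost_mul_source e)

theorem ghost_mul_edge_self (e : E) :
    ofGen K G (ghost e) * ofGen K G (edge e) = ofGen K G (vertex (G.r e)) := by
  simpa only [ofGen, map_mul] using mkHom_eq_of_rel K G (.ghost_mul_self e)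

theorem ghost_mul_edge_of_ne {e f : E} (h : e ≠ f) :
    ofGen K G (ghost e) * ofGen K G (edge f) = 0 := by
  simpa only [ofGen, map_mul, map_zero] using mkHom_eq_of_rel K G (.ghost_mul_of_ne e f h)

theorem sum_edge_mul_ghost {x : V} (hfin : {e | G.s e = x}.Finite)
    (hne : {e | G.s e = x}.Nonempty) :
    ∑ e ∈ hfin.toFinset, ofGen K G (edge e) * ofGen K G (ghost e) = ofGen K G (vertex x) := by
  simpa only [ofGen, map_sum, map_mul] using mkHom_eq_of_rel K G (.sum_edge_mul_ghost x hfin hne)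

end DefiningRelations

section UniversalProperty

variable {K G} {A : Type*} [NonUnitalRing A] [Module K A] [IsScalarTower K A A]
  [SMulCommClass K A A]

/-- The homomorphism on the free algebra that extends a map on the generators. -/
noncomputable def freeLift (f : Gen V E → A) : FreeAlg K V E →ₙₐ[K] A :=
  MonoidAlgebra.liftMagma K (FreeSemigroup.lift f)

theorem freeLift_gen (f : Gen V E → A) (g : Gen V E) : freeLift (K := K) f (gen K g) = f g := by
  simp [freeLift, gen, MonoidAlgebra.liftMagma]

theorem freeLift_eq_of_con {f : Gen V E → A}
    (hf : ∀ a b, Rel K G a b → freeLift f a = freeLift f b) {a b : FreeAlg K V E}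
    (h : con K G a b) : freeLift f a = freeLift f b := by
  change RingConGen.Rel (SMulRel K G) a b at h
  induction h with
  | of x y h =>
    obtain ⟨c, x', y', h, rfl, rfl⟩ := h
    rw [map_smul, map_smul, hf _ _ h]
  | refl x => rfl
  | symm _ ih => exact ih.symm
  | trans _ _ ih₁ ih₂ => exact ih₁.trans ih₂
  | add _ _ ih₁ ih₂ => rw [map_add, map_add, ih₁, ih₂]
  | mul _ _ ih₁ ih₂ => rw [map_mul, map_mul, ih₁, ih₂]

/-- The homomorphism on the Leavitt path algebra that extends a map on the generators which respects
the defining relations. -/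
noncomputable def lift (f : Gen V E → A)
    (hf : ∀ a b, Rel K G a b → freeLift f a = freeLift f b) : LeavittPathAlgebra K G →ₙₐ[K] A where
  toFun := Quotient.lift (freeLift f) fun _ _ h => freeLift_eq_of_con hf h
  map_smul' k := Quotient.ind fun a => map_smul (freeLift f) k a
  map_zero' := map_zero (freeLift f)
  map_add' := Quotient.ind₂ fun a b => map_add (freeLift f) a b
  map_mul' := Quotient.ind₂ fun a b => map_mul (freeLift f) a b

theorem lift_ofGen (f : Gen V E → A) (hf : ∀ a b, Rel K G a b → freeLift f a = freeLift f b)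
    (g : Gen V E) : lift f hf (ofGen K G g) = f g :=
  freeLift_gen f g

end UniversalProperty

section Representation

theorem freeLift_genOp_eq_of_rel {a b : FreeAlg K V E} (h : Rel K G a b) :
    freeLift (genOp K G) a = freeLift (genOp K G) b := by
  cases h <;> simp only [map_mul, map_sum, map_zero, freeLift_gen]
  case vertex_mul_self x => exact genOp_vertex_mul_self K G x
  case vertex_mul_of_ne x y h => exact genOp_vertex_mul_of_ne K G h
  case source_mul_edge e => exact genOp_source_mul_edge K G e
  case edge_mul_range e => exact genOp_edge_mul_range K G e
  case range_mul_ghost e => exact genOp_range_mul_ghost K G e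
  case ghost_mul_source e => exact genOp_ghost_mul_source K G e
  case ghost_mul_self e => exact genOp_ghost_mul_self K G e
  case ghost_mul_of_ne e f h => exact genOp_ghost_mul_of_ne K G h
  case sum_edge_mul_ghost x hfin hne => exact sum_genOp_edge_mul_ghost K G hfin hne

/-- The representation of the Leavitt path algebra on the space with basis the normal monomials. -/
noncomputable def rep : LeavittPathAlgebra K G →ₙₐ[K] Module.End K (NormalSpace K G) :=
  lift (genOp K G) fun _ _ => freeLift_genOp_eq_of_rel K G

theorem rep_ofGen (g : Gen V E) : rep K G (ofGen K G g) = genOp K G g := lift_ofGen _ _ g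

end Representation

section OfMonomial

/-- The element `e₁ ⋯ eₙ x f₁* ⋯ fₘ*` of the Leavitt path algebra. -/
noncomputable def ofMonomial (m : Monomial V E) : LeavittPathAlgebra K G :=
  m.real.foldr (fun e a => ofGen K G (edge e) * a)
    (m.ghost.foldl (fun a f => a * ofGen K G (ghost f)) (ofGen K G (vertex m.range)))

variable {K G} {e f : E} {p q : List E} {x y : V}

theorem ofMonomial_cons :
    ofMonomial K G ⟨e :: p, x, q⟩ = ofGen K G (edge e) * ofMonomial K G ⟨p, x, q⟩ := rfl

theorem mul_foldl_ghost (a b : LeavittPathAlgebra K G) (q : List E) :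
    a * q.foldl (fun a f => a * ofGen K G (ghost f)) b =
      q.foldl (fun a f => a * ofGen K G (ghost f)) (a * b) := by
  induction q generalizing b with
  | nil => rfl
  | cons f q ih => rw [List.foldl_cons, ih, List.foldl_cons, mul_assoc]

theorem vertex_mul_ofMonomial (h : G.IsPath y p x) :
    ofGen K G (vertex y) * ofMonomial K G ⟨p, x, q⟩ = ofMonomial K G ⟨p, x, q⟩ := by
  cases p with
  | nil =>
    obtain rfl := isPath_nil_iff.1 h
    simp only [ofMonomial, List.foldr_nil, mul_foldl_ghost, vertex_mul_self]
  | cons e p => rw [ofMonomial_cons, ← mul_assoc, ← (isPath_cons_iff.1 h).1, source_mul_edge]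

theorem vertex_mul_ofMonomial_of_not_isPath (hp : G.IsPathTo p x) (h : ¬ G.IsPath y p x) :
    ofGen K G (vertex y) * ofMonomial K G ⟨p, x, q⟩ = 0 := by
  obtain ⟨z, hz⟩ := hp
  have hyz : y ≠ z := by rintro rfl; exact h hz
  rw [← vertex_mul_ofMonomial hz, ← mul_assoc, vertex_mul_of_ne K G hyz, zero_mul]

theorem ghost_mul_ofMonomial_nil (e : E) (q : List E) :
    ofGen K G (ghost e) * ofMonomial K G ⟨[], G.s e, q⟩ = ofMonomial K G ⟨[], G.r e, e :: q⟩ := by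
  simp only [ofMonomial, List.foldr_nil, List.foldl_cons, mul_foldl_ghost, ghost_mul_source,
    range_mul_ghost]

theorem ofMonomial_singleton_cons :
    ofMonomial K G ⟨[e], G.r e, e :: q⟩ =
      ofGen K G (edge e) * ofGen K G (ghost e) * ofMonomial K G ⟨[], G.s e, q⟩ := by
  rw [ofMonomial_cons, ← ghost_mul_ofMonomial_nil, mul_assoc]

theorem ofMonomial_of_isSpecial (he : G.IsSpecial e) (q : List E) :
    ofMonomial K G ⟨[e], G.r e, e :: q⟩ = ofMonomial K G ⟨[], G.s e, q⟩ -
      ∑ f ∈ G.siblings e, ofMonomial K G ⟨[f], G.r f, f :: q⟩ := by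
  have hsum : ∑ f ∈ he.finite.toFinset, ofMonomial K G ⟨[f], G.r f, f :: q⟩ =
      ofMonomial K G ⟨[], G.s e, q⟩ := calc
    _ = ∑ f ∈ he.finite.toFinset, ofGen K G (edge f) * ofGen K G (ghost f) *
          ofMonomial K G ⟨[], G.s e, q⟩ := Finset.sum_congr rfl fun f hf => by
        rw [ofMonomial_singleton_cons, show G.s f = G.s e from he.finite.mem_toFinset.1 hf]
    _ = ofMonomial K G ⟨[], G.s e, q⟩ := by
        rw [← Finset.sum_mul, sum_edge_mul_ghost K G he.finite ⟨e, rfl⟩,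
          vertex_mul_ofMonomial (.nil _)]
  rw [← hsum, he.sum_eq_add_sum_siblings, add_sub_cancel_right]

end OfMonomial

section Intertwining

/-- The linear map from the space with basis the normal monomials to the Leavitt path algebra. -/
noncomputable def ofNormal : NormalSpace K G →ₗ[K] LeavittPathAlgebra K G :=
  Finsupp.linearCombination K fun m => ofMonomial K G m.1

variable {K G} {m : Monomial V E}

theorem ofNormal_normalSingle (h : G.IsNormal m) :
    ofNormal K G (normalSingle K G m) = ofMonomial K G m := by
  rw [normalSingle_of_isNormal h, ofNormal, Finsupp.linearCombination_single, one_smul]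

theorem ofNormal_genOp_vertex (y : V) (h : G.IsNormal m) :
    ofNormal K G (genOp K G (vertex y) (normalSingle K G m)) =
      ofGen K G (vertex y) * ofMonomial K G m := by
  obtain ⟨p, x, q⟩ := m
  by_cases hp : G.IsPath y p x
  · rw [genOp_vertex hp, vertex_mul_ofMonomial hp, ofNormal_normalSingle h]
  · rw [genOp_vertex_of_not_isPath hp, vertex_mul_ofMonomial_of_not_isPath h.real hp, map_zero]

theorem ofNormal_genOp_edge (e : E) (h : G.IsNormal m) :
    ofNormal K G (genOp K G (edge e) (normalSingle K G m)) =
      ofGen K G (edge e) * ofMonomial K G m := by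
  obtain ⟨p, x, q⟩ := m
  obtain hp | h' | ⟨q, rfl, rfl, rfl, he⟩ := h.cons_cases e
  · rw [genOp_edge_of_not_isPath hp, map_zero, ← edge_mul_range, mul_assoc,
      vertex_mul_ofMonomial_of_not_isPath h.real hp, mul_zero]
  · rw [genOp_edge h', ofNormal_normalSingle h', ofMonomial_cons]
  · rw [genOp_edge_of_isSpecial he h, map_sub, map_sum, ← ofMonomial_cons,
      ofMonomial_of_isSpecial he, ofNormal_normalSingle (isNormal_nil_cons_iff.1 h).2,
      Finset.sum_congr rfl fun f hf => ofNormal_normalSingle (h.sibling he hf)]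

theorem ofNormal_genOp_ghost (e : E) (h : G.IsNormal m) :
    ofNormal K G (genOp K G (ghost e) (normalSingle K G m)) =
      ofGen K G (ghost e) * ofMonomial K G m := by
  obtain ⟨p, x, q⟩ := m
  cases p with
  | nil =>
    by_cases hx : G.s e = x
    · subst hx
      rw [genOp_ghost_nil, ghost_mul_ofMonomial_nil,
        ofNormal_normalSingle (isNormal_nil_cons_iff.2 ⟨rfl, h⟩)]
    · rw [genOp_ghost_nil_of_ne hx, map_zero, ← ghost_mul_source, mul_assoc,
        vertex_mul_ofMonomial_of_not_isPath h.real fun h' => hx (isPath_nil_iff.1 h'), mul_zero]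
  | cons f p =>
    by_cases hf : f = e
    · subst hf
      rw [genOp_ghost_cons h, ofMonomial_cons, ← mul_assoc, ghost_mul_edge_self,
        vertex_mul_ofMonomial h.isPath, ofNormal_normalSingle h.of_cons]
    · rw [genOp_ghost_cons_of_ne hf, map_zero, ofMonomial_cons, ← mul_assoc,
        ghost_mul_edge_of_ne K G (Ne.symm hf), zero_mul]

theorem ofNormal_genOp (g : Gen V E) (v : NormalSpace K G) :
    ofNormal K G (genOp K G g v) = ofGen K G g * ofNormal K G v := by
  suffices h : ofNormal K G ∘ₗ genOp K G g = LinearMap.mulLeft K (ofGen K G g) ∘ₗ ofNormal K G from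
    LinearMap.congr_fun h v
  refine Finsupp.lhom_ext' fun ⟨m, hm⟩ => LinearMap.ext_ring ?_
  change ofNormal K G (genOp K G g (.single ⟨m, hm⟩ 1)) =
    ofGen K G g * ofNormal K G (.single ⟨m, hm⟩ 1)
  rw [← normalSingle_of_isNormal, ofNormal_normalSingle hm]
  cases g with
  | vertex y => exact ofNormal_genOp_vertex y hm
  | edge e => exact ofNormal_genOp_edge e hm
  | ghost e => exact ofNormal_genOp_ghost e hm

end Intertwining

section LinearIndependence

variable {K G}

open Classical in
theorem rep_ofMonomial {m : Monomial V E} (h : G.IsNormal m) (y : V) :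
    rep K G (ofMonomial K G m) (normalSingle K G ⟨[], y, []⟩) =
      if G.IsPath y m.ghost.reverse m.range then normalSingle K G m else 0 := by
  obtain ⟨p, x, q⟩ := m
  induction p with
  | cons e p ih =>
    rw [ofMonomial_cons, map_mul, Module.End.mul_apply, ih h.of_cons,
      apply_ite (rep K G _), map_zero, rep_ofGen, genOp_edge h]
  | nil =>
    induction q generalizing x with
    | nil =>
      change rep K G (ofGen K G (vertex x)) _ = _
      rw [rep_ofGen, List.reverse_nil, isPath_nil_iff]
      split_ifs with hyx
      · rw [hyx, genOp_vertex (.nil x)]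
      · exact genOp_vertex_of_not_isPath fun h => hyx (isPath_nil_iff.1 h).symm
    | cons f q ih =>
      obtain ⟨rfl, h'⟩ := isNormal_nil_cons_iff.1 h
      have hpath : G.IsPath y (f :: q).reverse (G.r f) ↔ G.IsPath y q.reverse (G.s f) := by
        simp [isPath_append_iff, isPath_singleton_iff]
      rw [← ghost_mul_ofMonomial_nil, map_mul, Module.End.mul_apply, ih _ h',
        apply_ite (rep K G _), map_zero, rep_ofGen, genOp_ghost_nil, if_congr hpath rfl rfl]

theorem linearIndependent_ofMonomial :
    LinearIndependent K fun m : {m // G.IsNormal m} => ofMonomial K G m.1 := by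
  choose y hy using fun m : {m // G.IsNormal m} => m.2.ghost
  let coord (m : {m // G.IsNormal m}) : LeavittPathAlgebra K G →ₗ[K] K :=
    Finsupp.lapply m ∘ₗ (LinearMap.applyₗ (normalSingle K G ⟨[], y m, []⟩)) ∘ₗ
      (rep K G : LeavittPathAlgebra K G →ₗ[K] Module.End K (NormalSpace K G))
  have hcoord (m m' : {m // G.IsNormal m}) : coord m (ofMonomial K G m'.1) =
      rep K G (ofMonomial K G m'.1) (normalSingle K G ⟨[], y m, []⟩) m := rfl
  refine .of_pairwise_dual_eq_zero_one _ coord (fun m m' hne => ?_) fun m => ?_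
  · change coord m (ofMonomial K G m'.1) = 0
    rw [hcoord, rep_ofMonomial m'.2]
    split_ifs
    · rw [normalSingle_of_isNormal m'.2, Finsupp.single_eq_of_ne hne]
    · rfl
  · rw [hcoord, rep_ofMonomial m.2, if_pos (hy m), normalSingle_of_isNormal m.2,
      Finsupp.single_eq_same]

end LinearIndependence

end LeavittPathAlgebra

/-! ## Growth -/

namespace Growth

open Filter Topology Asymptotics

section PowSpan

variable {K : Type v} [Field K] {A : Type u} [NonUnitalRing A] [Module K A]

theorem IsProd.mul_isProd {S : Set A} {a b : A} {j k : ℕ} (ha : IsProd S j a)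
    (hb : IsProd S k b) : IsProd S (j + k) (a * b) := by
  induction ha with
  | of h => exact Nat.add_comm k 1 ▸ .mul h hb
  | mul h _ ih =>
    rw [mul_assoc, Nat.add_right_comm]
    exact .mul h ih

theorem IsProd.mem_powSpan {W : Submodule K A} {a : A} {k n : ℕ} (h : IsProd (W : Set A) k a)
    (hkn : k ≤ n) : a ∈ powSpan W n :=
  Submodule.subset_span ⟨k, hkn, h⟩

theorem powSpan_mono (W : Submodule K A) : Monotone (powSpan W) := fun _ _ hmn =>
  Submodule.span_mono fun _ ⟨k, hk, h⟩ => ⟨k, hk.trans hmn, h⟩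

theorem mem_powSpan_one {W : Submodule K A} {a : A} (h : a ∈ W) : a ∈ powSpan W 1 :=
  (IsProd.of h).mem_powSpan le_rfl

variable [IsScalarTower K A A] [SMulCommClass K A A] {W : Submodule K A}

theorem mul_mem_powSpan {a b : A} {m n : ℕ} (ha : a ∈ powSpan W m) (hb : b ∈ powSpan W n) :
    a * b ∈ powSpan W (m + n) := by
  refine LinearMap.BilinMap.apply_apply_mem_of_mem_span _ _ _ (LinearMap.mul K A) ?_ a b ha hb
  rintro a ⟨j, hj, ha⟩ b ⟨k, hk, hb⟩
  exact (ha.mul_isProd hb).mem_powSpan (Nat.add_le_add hj hk)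

theorem powSpan_le_powSpan_mul {W' : Submodule K A} {k : ℕ} (h : W' ≤ powSpan W k) (n : ℕ) :
    powSpan W' n ≤ powSpan W (k * n) := by
  have hprod {j : ℕ} {a : A} (ha : IsProd (W' : Set A) j a) : a ∈ powSpan W (k * j) := by
    induction ha with
    | of ha => exact (Nat.mul_one k).symm ▸ h ha
    | mul ha _ ih =>
      rw [Nat.mul_succ, Nat.add_comm]
      exact mul_mem_powSpan (h ha) ih
  exact Submodule.span_le.2 fun a ⟨j, hj, ha⟩ =>
    powSpan_mono W (Nat.mul_le_mul_left k hj) (hprod ha)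

theorem powSpan_succ_le (W : Submodule K A) (n : ℕ) :
    powSpan W (n + 1) ≤ W ⊔ Submodule.map₂ (LinearMap.mul K A) W (powSpan W n) := by
  refine Submodule.span_le.2 fun a ⟨j, hj, ha⟩ => ?_
  cases ha with
  | of ha => exact Submodule.mem_sup_left ha
  | mul ha hb =>
    exact Submodule.mem_sup_right
      (Submodule.apply_mem_map₂ _ ha (hb.mem_powSpan (Nat.le_of_succ_le_succ hj)))

theorem finiteDimensional_powSpan [FiniteDimensional K W] (n : ℕ) :
    FiniteDimensional K (powSpan W n) := by
  induction n with
  | zero =>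
    have hempty : {a | ∃ k ≤ 0, IsProd (W : Set A) k a} = ∅ := by
      refine Set.eq_empty_of_forall_notMem fun a ⟨k, hk, ha⟩ => ?_
      cases ha <;> omega
    rw [powSpan, hempty, Submodule.span_empty]
    infer_instance
  | succ n ih =>
    have hfg : (W ⊔ Submodule.map₂ (LinearMap.mul K A) W (powSpan W n)).FG :=
      (Module.Finite.iff_fg.1 ‹_›).sup
        ((Module.Finite.iff_fg.1 ‹_›).map₂ _ (Module.Finite.iff_fg.1 ih))
    have := Module.Finite.iff_fg.2 hfg
    exact Submodule.finiteDimensional_of_le (powSpan_succ_le W n)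

theorem growthFun_mono [FiniteDimensional K W] : Monotone (growthFun W) := fun _ n hmn =>
  have := finiteDimensional_powSpan (W := W) n
  Submodule.finrank_mono (powSpan_mono W hmn)

theorem exists_mem_powSpan (hW : NonUnitalAlgebra.adjoin K (W : Set A) = ⊤) (a : A) :
    ∃ n, a ∈ powSpan W n := by
  have ha : a ∈ NonUnitalAlgebra.adjoin K (W : Set A) := hW ▸ NonUnitalAlgebra.mem_top
  induction ha using NonUnitalAlgebra.adjoin_induction with
  | mem a ha => exact ⟨1, mem_powSpan_one ha⟩
  | zero => exact ⟨0, zero_mem _⟩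
  | add a b _ _ iha ihb =>
    obtain ⟨m, hm⟩ := iha
    obtain ⟨n, hn⟩ := ihb
    exact ⟨max m n, add_mem (powSpan_mono W (le_max_left m n) hm)
      (powSpan_mono W (le_max_right m n) hn)⟩
  | mul a b _ _ iha ihb =>
    obtain ⟨m, hm⟩ := iha
    obtain ⟨n, hn⟩ := ihb
    exact ⟨m + n, mul_mem_powSpan hm hn⟩
  | smul c a _ ih =>
    obtain ⟨n, hn⟩ := ih
    exact ⟨n, Submodule.smul_mem _ c hn⟩

theorem exists_le_powSpan (hW : NonUnitalAlgebra.adjoin K (W : Set A) = ⊤)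
    (W' : Submodule K A) [FiniteDimensional K W'] : ∃ n, 0 < n ∧ W' ≤ powSpan W n := by
  obtain ⟨s, rfl⟩ := Module.Finite.iff_fg.1 ‹FiniteDimensional K W'›
  choose n hn using exists_mem_powSpan hW
  refine ⟨s.sup n + 1, Nat.succ_pos _, Submodule.span_le.2 fun a ha => ?_⟩
  exact powSpan_mono W ((Finset.le_sup ha).trans (Nat.le_succ _)) (hn a)

end PowSpan

section AsympLE

variable {f g h : ℕ → ℝ} {k : ℕ}

theorem AsympLE.trans (hfg : AsympLE f g) (hgh : AsympLE g h) : AsympLE f h := by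
  obtain ⟨c, hc, hfg⟩ := hfg
  obtain ⟨d, hd, hgh⟩ := hgh
  refine ⟨d * c, Nat.mul_pos hd hc, fun n hn => ?_⟩
  calc f n ≤ c * g (c * n) := hfg n hn
    _ ≤ c * (d * h (d * (c * n))) := by gcongr; exact hgh _ (Nat.mul_pos hc hn)
    _ = (d * c : ℕ) * h (d * c * n) := by rw [Nat.mul_assoc]; push_cast; ring

theorem asympLE_of_le_comp_mul (hg : 0 ≤ g) {c : ℕ} (hc : 0 < c)
    (h : ∀ n, 0 < n → f n ≤ g (c * n)) : AsympLE f g :=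
  ⟨c, hc, fun n hn => (h n hn).trans
    (le_mul_of_one_le_left (hg _) (Nat.one_le_cast.2 hc))⟩

theorem AsympLE.mul {f₁ f₂ g₁ g₂ : ℕ → ℝ} (h₁ : AsympLE f₁ g₁) (h₂ : AsympLE f₂ g₂)
    (hf₂ : 0 ≤ f₂) (hg₁ : 0 ≤ g₁) (hmono₁ : Monotone g₁) (hmono₂ : Monotone g₂) :
    AsympLE (f₁ * f₂) (g₁ * g₂) := by
  obtain ⟨c, hc, h₁⟩ := h₁
  obtain ⟨d, hd, h₂⟩ := h₂
  refine ⟨c * d, Nat.mul_pos hc hd, fun n hn => ?_⟩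
  have hle₁ : f₁ n ≤ c * g₁ (c * d * n) := (h₁ n hn).trans <| by
    gcongr; exact hmono₁ (Nat.mul_le_mul_right n (Nat.le_mul_of_pos_right c hd))
  have hle₂ : f₂ n ≤ d * g₂ (c * d * n) := (h₂ n hn).trans <| by
    gcongr; exact hmono₂ (Nat.mul_le_mul_right n (Nat.le_mul_of_pos_left d hc))
  calc f₁ n * f₂ n ≤ (c * g₁ (c * d * n)) * (d * g₂ (c * d * n)) :=
        mul_le_mul hle₁ hle₂ (hf₂ n) (mul_nonneg c.cast_nonneg (hg₁ _))
    _ = (c * d : ℕ) * (g₁ (c * d * n) * g₂ (c * d * n)) := by push_cast; ring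

theorem asympLE_pow_iff_isBigO (hf : 0 ≤ f) :
    AsympLE f (fun n => (n : ℝ) ^ k) ↔ f =O[atTop] fun n : ℕ => (n : ℝ) ^ k := by
  constructor
  · rintro ⟨c, -, hc⟩
    refine .of_bound (c ^ (k + 1)) ?_
    filter_upwards [eventually_gt_atTop 0] with n hn
    rw [Real.norm_of_nonneg (hf n), Real.norm_of_nonneg (by positivity)]
    refine (hc n hn).trans_eq ?_
    push_cast
    ring
  · intro h
    obtain ⟨C, hC, hle⟩ := bound_of_isBigO_nat_atTop h
    have hCc : C ≤ (⌈C⌉₊ + 1 : ℕ) := (Nat.le_ceil C).trans (Nat.cast_le.2 (Nat.le_succ _))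
    refine ⟨⌈C⌉₊ + 1, Nat.succ_pos _, fun n hn => ?_⟩
    calc f n ≤ ‖f n‖ := Real.le_norm_self _
      _ ≤ C * ‖(n : ℝ) ^ k‖ := hle (by positivity)
      _ = C * (n : ℝ) ^ k := by rw [Real.norm_of_nonneg (by positivity)]
      _ ≤ (⌈C⌉₊ + 1 : ℕ) * (((⌈C⌉₊ + 1) * n : ℕ) : ℝ) ^ k := by
        gcongr
        exact Nat.le_mul_of_pos_left n (Nat.succ_pos _)

theorem pow_isBigO_of_asympLE (hg : 0 ≤ g) (hmono : Monotone g)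
    (h : AsympLE (fun n => (n : ℝ) ^ k) g) : (fun n : ℕ => (n : ℝ) ^ k) =O[atTop] g := by
  obtain ⟨c, hc, h⟩ := h
  refine .of_bound ((2 * c) ^ k * c) ?_
  filter_upwards [eventually_ge_atTop c] with n hn
  have hq : 0 < n / c := Nat.div_pos hn hc
  have hn' : n ≤ 2 * c * (n / c) := by
    have hlt := Nat.lt_mul_div_succ n hc
    have hle := Nat.mul_le_mul_left c (show n / c + 1 ≤ 2 * (n / c) by omega)
    linarith
  rw [Real.norm_of_nonneg (by positivity), Real.norm_of_nonneg (hg n)]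
  calc (n : ℝ) ^ k ≤ ((2 * c * (n / c) : ℕ) : ℝ) ^ k := by gcongr
    _ = (2 * c) ^ k * ((n / c : ℕ) : ℝ) ^ k := by push_cast; ring
    _ ≤ (2 * c) ^ k * (c * g (c * (n / c))) := by gcongr; exact h _ hq
    _ ≤ (2 * c) ^ k * c * g n := by
      rw [mul_assoc]
      gcongr
      exact hmono (Nat.mul_div_le n c)

theorem not_two_pow_asympLE_pow : ¬ AsympLE (fun n => 2 ^ n) (fun n => (n : ℝ) ^ k) := by
  intro h
  have hbig := (asympLE_pow_iff_isBigO fun n => by positivity).1 h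
  have hlittle : (fun n : ℕ => (n : ℝ) ^ k) =o[atTop] fun n => (2 : ℝ) ^ n :=
    isLittleO_pow_const_const_pow_of_one_lt k one_lt_two
  exact isLittleO_irrefl (Frequently.of_forall fun n => by positivity)
    (hbig.trans_isLittleO hlittle)

end AsympLE

section GKDim

theorem tendsto_logb_of_isTheta_pow {f : ℕ → ℝ} {k : ℕ}
    (h : f =Θ[atTop] fun n : ℕ => (n : ℝ) ^ k) :
    Tendsto (fun n : ℕ => Real.logb n (f n)) atTop (𝓝 k) := by
  obtain ⟨β, hβ, hle⟩ := h.1.exists_pos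
  obtain ⟨α, hα, hge⟩ := h.2.exists_pos
  have hlog : Tendsto (fun n : ℕ => Real.log n) atTop atTop :=
    Real.tendsto_log_atTop.comp tendsto_natCast_atTop_atTop
  have hlim (γ : ℝ) : Tendsto (fun n : ℕ => Real.log γ / Real.log n + k) atTop (𝓝 k) := by
    simpa only [zero_add] using (hlog.const_div_atTop (Real.log γ)).add_const (k : ℝ)
  have hlogb {γ : ℝ} (hγ : 0 < γ) {n : ℕ} (hn : 1 < n) :
      Real.logb n (γ * (n : ℝ) ^ k) = Real.log γ / Real.log n + k := by
    have hn₀ : Real.log n ≠ 0 := (Real.log_pos (Nat.one_lt_cast.2 hn)).ne'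
    rw [Real.logb, Real.log_mul hγ.ne' (by positivity), Real.log_pow, add_div,
      mul_div_cancel_right₀ _ hn₀]
  refine tendsto_of_tendsto_of_tendsto_of_le_of_le' (hlim α⁻¹) (hlim β) ?_ ?_
  all_goals
    filter_upwards [hle.bound, hge.bound, eventually_gt_atTop 1] with n hle hge hn
    have hpow : 0 < (n : ℝ) ^ k := by positivity
    rw [Real.norm_of_nonneg hpow.le] at hle hge
    rw [← inv_mul_le_iff₀ hα] at hge
    rw [← hlogb (by positivity) hn, ← Real.logb_abs _ (f n)]
  · exact Real.logb_le_logb_of_le (Nat.one_lt_cast.2 hn) (by positivity) hge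
  · exact Real.logb_le_logb_of_le (Nat.one_lt_cast.2 hn)
      (lt_of_lt_of_le (by positivity) hge) hle

variable {K : Type v} [Field K] {A : Type u} [NonUnitalRing A] [Module K A]

theorem hasPolynomialGrowth_of_isBigO {W : Submodule K A} {k : ℕ}
    (h : (fun n => (growthFun W n : ℝ)) =O[atTop] fun n : ℕ => (n : ℝ) ^ k) :
    HasPolynomialGrowth W := by
  refine ⟨k + 1, Nat.succ_pos k, (asympLE_pow_iff_isBigO fun n => Nat.cast_nonneg _).2 ?_⟩
  refine h.trans (.of_bound 1 ?_)
  filter_upwards [eventually_ge_atTop 1] with n hn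
  rw [one_mul, norm_pow, norm_pow, Real.norm_natCast]
  exact pow_le_pow_right₀ (Nat.one_le_cast.2 hn) (Nat.le_succ k)

variable [IsScalarTower K A A] [SMulCommClass K A A] {W W' : Submodule K A}

theorem growthFun_asympLE_growthFun (hW : IsGeneratingSpace W) [FiniteDimensional K W'] :
    AsympLE (fun n => growthFun W' n) (fun n => growthFun W n) := by
  have := hW.1
  obtain ⟨k, hk, hle⟩ := exists_le_powSpan hW.2 W'
  refine asympLE_of_le_comp_mul (fun n => Nat.cast_nonneg _) hk fun n _ => Nat.cast_le.2 ?_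
  have := finiteDimensional_powSpan (W := W) (k * n)
  exact Submodule.finrank_mono (powSpan_le_powSpan_mul hle n)

theorem gkDim_eq_of_isBigO_of_asympLE [FiniteDimensional K W] {k : ℕ}
    (hle : (fun n => (growthFun W n : ℝ)) =O[atTop] fun n : ℕ => (n : ℝ) ^ k)
    (hge : AsympLE (fun n => (n : ℝ) ^ k) fun n => growthFun W n) :
    gkDim W = ((k : ℝ) : EReal) := by
  have hmono : Monotone fun n => (growthFun W n : ℝ) := Nat.mono_cast.comp growthFun_mono
  have htheta : (fun n => (growthFun W n : ℝ)) =Θ[atTop] fun n : ℕ => (n : ℝ) ^ k :=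
    ⟨hle, pow_isBigO_of_asympLE (fun n => Nat.cast_nonneg _) hmono hge⟩
  exact ((continuous_coe_real_ereal.tendsto _).comp
    (tendsto_logb_of_isTheta_pow htheta)).limsup_eq

end GKDim

end Growth

/-! ## Growth of the Leavitt path algebra -/

namespace DirectedGraph

variable {V : Type u} {E : Type v} (G : DirectedGraph V E)

/-- The normal monomials with at most `n` edges and ghost edges. -/
def normalMonomials (n : ℕ) : Set (Monomial V E) := {m | G.IsNormal m ∧ m.length ≤ n}

theorem finite_normalMonomials [Finite V] [Finite E] (n : ℕ) : (G.normalMonomials n).Finite := by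
  have hinj : Function.Injective fun m : Monomial V E => (m.real, m.range, m.ghost) :=
    fun m m' h => by cases m; cases m'; simpa using h
  refine (((List.finite_length_le E n).prod (Set.finite_univ.prod
    (List.finite_length_le E n))).preimage hinj.injOn).subset fun m hm => ?_
  have hlen : m.real.length + m.ghost.length ≤ n := hm.2
  exact ⟨show m.real.length ≤ n by omega, trivial, show m.ghost.length ≤ n by omega⟩

end DirectedGraph

namespace LeavittPath

open DirectedGraph Gen

variable (K : Type w) [Field K] {V : Type u} {E : Type v} (G : DirectedGraph V E)

/-- The span of the normal monomials of length at most `n` in the space of all of them. -/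
def lengthLE (n : ℕ) : Submodule K (NormalSpace K G) := Finsupp.supported K K {m | m.1.length ≤ n}

variable {K G} {m : Monomial V E} {n : ℕ}

theorem normalSingle_mem_lengthLE (h : m.length ≤ n) : normalSingle K G m ∈ lengthLE K G n := by
  by_cases hm : G.IsNormal m
  · rw [normalSingle_of_isNormal hm]
    exact Finsupp.single_mem_supported K _ h
  · rw [normalSingle_of_not_isNormal hm]
    exact zero_mem _

theorem lengthLE_eq_span : lengthLE K G n = Submodule.span K
    (normalSingle K G '' G.normalMonomials n) := by
  rw [lengthLE, Finsupp.supported_eq_span_single]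
  congr 1
  ext v
  constructor
  · rintro ⟨m, hm, rfl⟩
    exact ⟨m.1, ⟨m.2, hm⟩, normalSingle_of_isNormal m.2⟩
  · rintro ⟨m, ⟨hm, hlen⟩, rfl⟩
    exact ⟨⟨m, hm⟩, hlen, (normalSingle_of_isNormal hm).symm⟩

theorem genAct_mem_lengthLE (g : Gen V E) (h : m.length ≤ n) :
    genAct K G g m ∈ lengthLE K G (n + 1) := by
  have hmem {m' : Monomial V E} (h' : m'.length ≤ m.length + 1) :
      normalSingle K G m' ∈ lengthLE K G (n + 1) :=
    normalSingle_mem_lengthLE (h'.trans (Nat.succ_le_succ h))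
  obtain ⟨p, x, q⟩ := m
  match g, p with
  | vertex y, p =>
    rw [genAct]
    split_ifs
    exacts [hmem (Nat.le_succ _), zero_mem _]
  | edge e, p =>
    rw [genAct]
    split_ifs with hs
    · obtain ⟨rfl, hq, -⟩ := hs
      obtain ⟨q, rfl⟩ := List.head?_eq_some_iff.1 hq
      refine sub_mem (hmem ?_) (sum_mem fun f _ => hmem ?_) <;> grind [Monomial.length]
    · exact hmem (by grind [Monomial.length])
  | ghost e, [] =>
    rw [genAct]
    split_ifs
    exacts [hmem (by grind [Monomial.length]), zero_mem _]
  | ghost e, f :: p =>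
    rw [genAct]
    split_ifs
    exacts [hmem (by grind [Monomial.length]), zero_mem _]

theorem genOp_mem_lengthLE (g : Gen V E) {v : NormalSpace K G} (hv : v ∈ lengthLE K G n) :
    genOp K G g v ∈ lengthLE K G (n + 1) := by
  suffices h : lengthLE K G n ≤ (lengthLE K G (n + 1)).comap (genOp K G g) from h hv
  rw [lengthLE_eq_span, Submodule.span_le]
  rintro _ ⟨m, hm, rfl⟩
  rw [SetLike.mem_coe, Submodule.mem_comap, genOp_normalSingle g hm.1]
  exact genAct_mem_lengthLE g hm.2

theorem finrank_lengthLE [Finite V] [Finite E] (n : ℕ) :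
    Module.finrank K (lengthLE K G n) = (G.normalMonomials n).ncard := by
  have himage : G.normalMonomials n =
      Subtype.val '' {m : {m // G.IsNormal m} | m.1.length ≤ n} := by
    ext m
    simp [normalMonomials, and_comm]
  have hfin : {m : {m // G.IsNormal m} | m.1.length ≤ n}.Finite :=
    .of_finite_image (himage ▸ G.finite_normalMonomials n) Subtype.val_injective.injOn
  have := hfin.fintype
  rw [himage, Set.ncard_image_of_injective _ Subtype.val_injective, lengthLE,
    (Finsupp.supportedEquivFinsupp _).finrank_eq, Module.finrank_finsupp_self,
    ← Nat.card_eq_fintype_card, Nat.card_coe_set_eq]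

end LeavittPath

namespace LeavittPathAlgebra

open DirectedGraph LeavittPath Gen Growth

variable (K : Type w) [Field K] {V : Type u} {E : Type v} (G : DirectedGraph V E)

/-- The space spanned by the generators. -/
noncomputable def genSpace : Submodule K (LeavittPathAlgebra K G) :=
  Submodule.span K (Set.range (ofGen K G))

variable {K G} in
theorem ofGen_mem_genSpace (g : Gen V E) : ofGen K G g ∈ genSpace K G :=
  Submodule.subset_span ⟨g, rfl⟩

theorem adjoin_genSpace :
    NonUnitalAlgebra.adjoin K (genSpace K G : Set (LeavittPathAlgebra K G)) = ⊤ := by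
  have hword (z : FreeSemigroup (Gen V E)) : mkHom K G (MonoidAlgebra.single z 1) ∈
      NonUnitalAlgebra.adjoin K (genSpace K G : Set (LeavittPathAlgebra K G)) := by
    induction z using FreeSemigroup.recOnMul with
    | ih1 g => exact NonUnitalAlgebra.subset_adjoin K (ofGen_mem_genSpace g)
    | ih2 g z hg hz =>
      rw [← mul_one (1 : K), ← MonoidAlgebra.single_mul_single, map_mul]
      exact mul_mem hg hz
  refine eq_top_iff.2 fun a _ => ?_
  obtain ⟨a, rfl⟩ := mkHom_surjective K G a
  induction a using MonoidAlgebra.induction_linear with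
  | zero => rw [map_zero]; exact zero_mem _
  | add a b ha hb => rw [map_add]; exact add_mem (ha trivial) (hb trivial)
  | single z k =>
    rw [← mul_one k, ← smul_eq_mul, ← MonoidAlgebra.smul_single, map_smul]
    exact SMulMemClass.smul_mem _ (hword z)

theorem isGeneratingSpace_genSpace [Finite V] [Finite E] : IsGeneratingSpace (genSpace K G) := by
  have hrange : Set.range (ofGen K G) = Set.range (ofGen K G ∘ vertex) ∪
      (Set.range (ofGen K G ∘ edge) ∪ Set.range (ofGen K G ∘ ghost)) := by
    ext a
    constructor
    · rintro ⟨_ | _ | _, rfl⟩ <;> simp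
    · rintro (⟨x, rfl⟩ | ⟨e, rfl⟩ | ⟨e, rfl⟩) <;> exact ⟨_, rfl⟩
  have hfin : (Set.range (ofGen K G)).Finite := by
    rw [hrange]
    exact (Set.finite_range _).union ((Set.finite_range _).union (Set.finite_range _))
  exact ⟨FiniteDimensional.span_of_finite K hfin, adjoin_genSpace K G⟩

variable {K G} {m : Monomial V E} {n : ℕ}

theorem exists_ofGen_mul_vertex (g : Gen V E) :
    ∃ x, ofGen K G g * ofGen K G (vertex x) = ofGen K G g := by
  cases g with
  | vertex x => exact ⟨x, vertex_mul_self K G x⟩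
  | edge e => exact ⟨G.r e, edge_mul_range K G e⟩
  | ghost e => exact ⟨G.s e, ghost_mul_source K G e⟩

theorem genSpace_mul_mem_map_lengthLE {a : LeavittPathAlgebra K G} (ha : a ∈ genSpace K G)
    {v : NormalSpace K G} (hv : v ∈ lengthLE K G n) :
    a * ofNormal K G v ∈ (lengthLE K G (n + 1)).map (ofNormal K G) := by
  suffices h : genSpace K G ≤ ((lengthLE K G (n + 1)).map (ofNormal K G)).comap
      (LinearMap.mulRight K (ofNormal K G v)) from h ha
  refine Submodule.span_le.2 ?_
  rintro _ ⟨g, rfl⟩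
  exact ⟨genOp K G g v, genOp_mem_lengthLE g hv, ofNormal_genOp g v⟩

theorem genSpace_le_map_lengthLE :
    genSpace K G ≤ (lengthLE K G 1).map (ofNormal K G) := by
  refine Submodule.span_le.2 ?_
  rintro _ ⟨g, rfl⟩
  obtain ⟨x, hx⟩ := exists_ofGen_mul_vertex (K := K) (G := G) g
  have hvertex : ofNormal K G (normalSingle K G ⟨[], x, []⟩) = ofGen K G (vertex x) :=
    ofNormal_normalSingle (isNormal_nil_iff.2 isPathTo_nil)
  rw [← hx, ← hvertex]
  exact genSpace_mul_mem_map_lengthLE (ofGen_mem_genSpace g) (normalSingle_mem_lengthLE le_rfl)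

theorem ofMonomial_mem_powSpan (hm : G.IsNormal m) (hlen : m.length ≤ n + 1) :
    ofMonomial K G m ∈ powSpan (genSpace K G) (n + 1) := by
  induction n generalizing m with
  | zero =>
    match m with
    | ⟨[], x, []⟩ => exact mem_powSpan_one (ofGen_mem_genSpace _)
    | ⟨[e], x, []⟩ =>
      obtain rfl := isPath_nil_iff.1 hm.isPath
      have he : ofMonomial K G ⟨[e], G.r e, []⟩ = ofGen K G (edge e) := edge_mul_range K G e
      exact he ▸ mem_powSpan_one (ofGen_mem_genSpace _)
    | ⟨[], x, [e]⟩ =>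
      obtain rfl := (isNormal_nil_cons_iff.1 hm).1
      have he : ofMonomial K G ⟨[], G.r e, [e]⟩ = ofGen K G (ghost e) :=
        (ghost_mul_ofMonomial_nil e []).symm.trans (ghost_mul_source K G e)
      exact he ▸ mem_powSpan_one (ofGen_mem_genSpace _)
    | ⟨_ :: _ :: _, x, _⟩ | ⟨_ :: _, x, _ :: _⟩ | ⟨[], x, _ :: _ :: _⟩ =>
      exact absurd hlen (by simp [Monomial.length]; try omega)
  | succ n ih =>
    rw [Nat.add_comm]
    match m with
    | ⟨[], x, []⟩ =>
      exact powSpan_mono _ (by omega) (mem_powSpan_one (ofGen_mem_genSpace (vertex x)))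
    | ⟨e :: p, x, q⟩ =>
      refine mul_mem_powSpan (mem_powSpan_one (ofGen_mem_genSpace (edge e))) (ih hm.of_cons ?_)
      grind [Monomial.length]
    | ⟨[], x, e :: q⟩ =>
      obtain ⟨rfl, hq⟩ := isNormal_nil_cons_iff.1 hm
      rw [← ghost_mul_ofMonomial_nil]
      refine mul_mem_powSpan (mem_powSpan_one (ofGen_mem_genSpace (ghost e))) (ih hq ?_)
      grind [Monomial.length]

theorem powSpan_genSpace (hn : n ≠ 0) :
    powSpan (genSpace K G) n = (lengthLE K G n).map (ofNormal K G) := by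
  have hprod {k : ℕ} {a : LeavittPathAlgebra K G} (ha : IsProd (genSpace K G : Set _) k a) :
      a ∈ (lengthLE K G k).map (ofNormal K G) := by
    induction ha with
    | of ha => exact genSpace_le_map_lengthLE ha
    | mul ha _ ih =>
      obtain ⟨v, hv, rfl⟩ := ih
      exact genSpace_mul_mem_map_lengthLE ha hv
  refine le_antisymm (Submodule.span_le.2 fun a ⟨k, hk, ha⟩ => ?_) ?_
  · exact Submodule.map_mono (Finsupp.supported_mono fun m hm => hm.trans hk) (hprod ha)
  · rw [lengthLE_eq_span, Submodule.map_span_le]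
    rintro _ ⟨m, hm, rfl⟩
    obtain ⟨n, rfl⟩ := Nat.exists_eq_succ_of_ne_zero hn
    rw [ofNormal_normalSingle hm.1]
    exact ofMonomial_mem_powSpan hm.1 hm.2

theorem growthFun_genSpace [Finite V] [Finite E] (hn : n ≠ 0) :
    growthFun (genSpace K G) n = (G.normalMonomials n).ncard := by
  have hinj : Function.Injective (ofNormal K G) := linearIndependent_ofMonomial
  rw [growthFun, powSpan_genSpace hn, ← finrank_lengthLE (K := K),
    (Submodule.equivMapOfInjective _ hinj _).finrank_eq]

end LeavittPathAlgebra

/-! ## Cycles -/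

namespace DirectedGraph

variable {V : Type u} {E : Type v} {G : DirectedGraph V E} {C D : G.Subgraph} {e : E} {p q : List E}
  {x y z : V}

section Reach

variable (G) in
/-- There is a path from `x` to `y`. -/
def Reach (x y : V) : Prop := ∃ p, G.IsPath x p y

theorem Reach.refl (x : V) : G.Reach x x := ⟨[], .nil x⟩

theorem Reach.trans : G.Reach x y → G.Reach y z → G.Reach x z
  | ⟨_, hp⟩, ⟨_, hq⟩ => ⟨_, hp.append hq⟩

theorem reach_range (e : E) : G.Reach (G.s e) (G.r e) := ⟨[e], isPath_singleton e⟩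

variable (G) in
theorem wellFounded_reach_and_not_reach [Finite V] :
    WellFounded fun x y => G.Reach x y ∧ ¬ G.Reach y x := by
  let : Preorder V := { le := G.Reach, le_refl := Reach.refl, le_trans := fun _ _ _ => Reach.trans }
  exact Finite.to_wellFoundedLT.wf

theorem IsPath.exists_edge_into (h : G.IsPath x p y) {S : Set V} (hx : x ∉ S) (hy : y ∈ S) :
    ∃ e, G.Reach x (G.s e) ∧ G.s e ∉ S ∧ G.r e ∈ S := by
  induction h with
  | nil => exact absurd hy hx
  | cons e _ ih =>
    by_cases he : G.r e ∈ S
    · exact ⟨e, .refl _, hx, he⟩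
    · obtain ⟨f, hf, hfS⟩ := ih he hy
      exact ⟨f, (reach_range e).trans hf, hfS⟩

theorem Reach.exists_isPath_nodup (h : G.Reach x y) :
    ∃ p, G.IsPath x p y ∧ (y :: p.map G.s).Nodup := by
  obtain ⟨p, hp⟩ := h
  induction hp with
  | nil x => exact ⟨[], .nil x, List.nodup_singleton x⟩
  | @cons e _ y _ ih =>
    obtain ⟨p, hp, hnd⟩ := ih
    obtain ⟨hy, hnd⟩ := List.nodup_cons.1 hnd
    by_cases hey : G.s e = y
    · exact ⟨[], hey ▸ .nil _, List.nodup_singleton y⟩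
    by_cases hep : G.s e ∈ p.map G.s
    · obtain ⟨f, hf, hfe⟩ := List.mem_map.1 hep
      obtain ⟨a, b, rfl⟩ := List.append_of_mem hf
      obtain ⟨z, -, hb⟩ := isPath_append_iff.1 hp
      have hsub : List.Sublist ((f :: b).map G.s) ((a ++ f :: b).map G.s) :=
        (List.sublist_append_right a (f :: b)).map G.s
      exact ⟨f :: b, isPath_cons_iff.2 ⟨hfe, (isPath_cons_iff.1 hb).2⟩,
        List.nodup_cons.2 ⟨fun hyb => hy (hsub.subset hyb), hnd.sublist hsub⟩⟩
    · refine ⟨e :: p, .cons e hp, List.nodup_cons.2 ⟨?_, List.nodup_cons.2 ⟨hep, hnd⟩⟩⟩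
      rw [List.map_cons, List.mem_cons, not_or]
      exact ⟨Ne.symm hey, hy⟩

end Reach

section CyclicPath

theorem IsPath.cons_map_r (h : G.IsPath x p y) : x :: p.map G.r = p.map G.s ++ [y] := by
  induction h with
  | nil => rfl
  | cons e _ ih => rw [List.map_cons, List.map_cons, List.cons_append, ih]

theorem IsPath.map_r_perm (h : G.IsPath x p x) : (p.map G.r).Perm (p.map G.s) :=
  (List.perm_cons x).1 (h.cons_map_r ▸ List.perm_append_singleton x _)

theorem IsPath.mem_verts_subgraphOf_iff (h : G.IsPath x p x) :
    y ∈ (G.subgraphOf p).verts ↔ ∃ e ∈ p, G.s e = y := by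
  constructor
  · rintro ⟨e, he, rfl | rfl⟩
    · exact ⟨e, he, rfl⟩
    · exact List.mem_map.1 (h.map_r_perm.subset (List.mem_map_of_mem he))
  · rintro ⟨e, he, rfl⟩
    exact ⟨e, he, .inl rfl⟩

namespace Subgraph.IsCycle

theorem exists_isPath (hC : C.IsCycle) (hx : x ∈ C.verts) :
    ∃ p, p ≠ [] ∧ G.IsPath x p x ∧ (p.map G.s).Nodup ∧ C = G.subgraphOf p := by
  obtain ⟨p, ⟨-, ⟨y, hy⟩, hnd⟩, rfl⟩ := hC
  obtain ⟨e, he, rfl⟩ := hy.mem_verts_subgraphOf_iff.1 hx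
  obtain ⟨a, b, rfl⟩ := List.append_of_mem he
  obtain ⟨z, ha, hb⟩ := isPath_append_iff.1 hy
  obtain rfl := (isPath_cons_iff.1 hb).1
  refine ⟨e :: b ++ a, List.cons_ne_nil _ _, hb.append ha, ?_, ?_⟩
  · rw [List.map_append] at hnd ⊢
    exact List.nodup_append_comm.1 hnd
  · ext <;> simp only [subgraphOf, List.mem_append, or_comm]

theorem exists_edge_from (hC : C.IsCycle) (hx : x ∈ C.verts) : ∃ e ∈ C.edges, G.s e = x := by
  obtain ⟨p, ⟨-, ⟨y, hy⟩, -⟩, rfl⟩ := hC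
  exact hy.mem_verts_subgraphOf_iff.1 hx

theorem reach (hC : C.IsCycle) (hx : x ∈ C.verts) (hy : y ∈ C.verts) : G.Reach x y := by
  obtain ⟨p, -, hp, -, rfl⟩ := hC.exists_isPath hx
  obtain ⟨e, he, rfl⟩ := hp.mem_verts_subgraphOf_iff.1 hy
  obtain ⟨a, b, rfl⟩ := List.append_of_mem he
  obtain ⟨z, ha, hb⟩ := isPath_append_iff.1 hp
  obtain rfl := (isPath_cons_iff.1 hb).1
  exact ⟨a, ha⟩

theorem s_injOn (hC : C.IsCycle) : Set.InjOn G.s C.edges := by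
  obtain ⟨p, ⟨-, -, hnd⟩, rfl⟩ := hC
  exact List.inj_on_of_nodup_map hnd

theorem r_injOn (hC : C.IsCycle) : Set.InjOn G.r C.edges := by
  obtain ⟨p, ⟨-, ⟨x, hx⟩, hnd⟩, rfl⟩ := hC
  exact List.inj_on_of_nodup_map (hx.map_r_perm.nodup_iff.2 hnd)

end Subgraph.IsCycle

theorem exists_isCycle_mem_edges (h : G.Reach (G.r e) (G.s e)) :
    ∃ C : G.Subgraph, C.IsCycle ∧ e ∈ C.edges := by
  obtain ⟨p, hp, hnd⟩ := h.exists_isPath_nodup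
  exact ⟨G.subgraphOf (e :: p), ⟨e :: p, ⟨List.cons_ne_nil _ _, ⟨_, .cons e hp⟩, hnd⟩, rfl⟩,
    List.mem_cons_self⟩

end CyclicPath

section HasExit

theorem Subgraph.mem_verts_of_reach (hC : ¬ C.HasExit) (hx : x ∈ C.verts) (h : G.Reach x y) :
    y ∈ C.verts := by
  by_contra hy
  obtain ⟨p, hp⟩ := h
  obtain ⟨e, -, hs, hr⟩ := hp.exists_edge_into (S := C.vertsᶜ) (not_not.2 hx) hy
  exact hC ⟨e, not_not.1 hs, fun he => hr (C.r_mem e he)⟩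

theorem Subgraph.IsCycle.isSpecial_of_not_hasExit [Finite E] (hC : C.IsCycle) (hexit : ¬ C.HasExit)
    (he : e ∈ C.edges) : G.IsSpecial e := by
  obtain ⟨f, hfe, hf⟩ := exists_isSpecial (Set.toFinite {f | G.s f = G.s e}) ⟨e, rfl⟩
  have hfC : f ∈ C.edges := by
    by_contra h
    exact hexit ⟨f, hfe ▸ C.s_mem e he, h⟩
  rwa [← hC.s_injOn hfC he hfe]

theorem Subgraph.IsCycle.exists_not_isSpecial_of_hasExit (hC : C.IsCycle) (hexit : C.HasExit) :
    ∃ e, G.s e ∈ C.verts ∧ ¬ G.IsSpecial e := by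
  obtain ⟨f, hf, hfC⟩ := hexit
  obtain ⟨e, he, hef⟩ := hC.exists_edge_from hf
  by_cases hs : G.IsSpecial e
  · exact ⟨f, hf, fun hs' => hfC (hs.eq hs' hef ▸ he)⟩
  · exact ⟨e, C.s_mem e he, hs⟩

end HasExit

section CyclesDisjoint

variable (G) in
/-- Any two distinct cycles have no common vertex. -/
def CyclesDisjoint : Prop :=
  ∀ C D : G.Subgraph, C.IsCycle → D.IsCycle → C ≠ D → Disjoint C.verts D.verts

theorem CyclesDisjoint.eq (H : G.CyclesDisjoint) (hC : C.IsCycle) (hD : D.IsCycle)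
    (hxC : x ∈ C.verts) (hxD : x ∈ D.verts) : C = D := by
  by_contra h
  exact Set.disjoint_left.1 (H C D hC hD h) hxC hxD

theorem CyclesDisjoint.mem_edges (H : G.CyclesDisjoint) (hC : C.IsCycle)
    (hr : G.r e ∈ C.verts) (h : G.Reach (G.r e) (G.s e)) : e ∈ C.edges := by
  obtain ⟨D, hD, he⟩ := exists_isCycle_mem_edges h
  rwa [H.eq hC hD hr (D.r_mem e he)]

end CyclesDisjoint

end DirectedGraph

/-! ## Chains of cycles -/

namespace DirectedGraph

variable {V : Type u} {E : Type v} {G : DirectedGraph V E} {C : G.Subgraph} {l : List G.Subgraph}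
  {x y : V}

/-- The last cycle of the chain, if any, has a path to `x`. -/
def ChainReaches (l : List G.Subgraph) (x : V) : Prop :=
  ∀ C ∈ l.getLast?, ∃ y ∈ C.verts, G.Reach y x

theorem isCycleChain_nil : IsCycleChain ([] : List G.Subgraph) :=
  ⟨by simp, List.nodup_nil, List.isChain_nil⟩

theorem isCycleChain_append_singleton_iff : IsCycleChain (l ++ [C]) ↔
    IsCycleChain l ∧ C.IsCycle ∧ C ∉ l ∧ ∀ D ∈ l.getLast?, D.Reaches C := by
  have hmem : (∀ D ∈ l ++ [C], D.IsCycle) ↔ (∀ D ∈ l, D.IsCycle) ∧ C.IsCycle := by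
    simp [or_imp, forall_and]
  rw [IsCycleChain, IsCycleChain, hmem, List.nodup_append_comm, List.singleton_append,
    List.nodup_cons, List.isChain_append]
  simp only [List.isChain_singleton, List.head?_cons, Option.mem_some, true_and, forall_eq']
  tauto

theorem IsCycleChain.reach_of_mem (hl : IsCycleChain l) (hx : ChainReaches l x) (hC : C ∈ l) :
    ∃ y ∈ C.verts, G.Reach y x := by
  induction l using List.reverseRecOn generalizing C x with
  | nil => exact absurd hC List.not_mem_nil
  | append_singleton l D ih =>
    obtain ⟨y, hy, hyx⟩ := hx D (by simp)
    obtain ⟨hl, hD, -, hlast⟩ := isCycleChain_append_singleton_iff.1 hl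
    obtain hC | hC := List.mem_append.1 hC
    · refine ih hl (fun D' hD' => ?_) hC
      obtain ⟨a, ha, b, hb, hab⟩ := hlast D' hD'
      exact ⟨a, ha, .trans hab ((hD.reach hb hy).trans hyx)⟩
    · obtain rfl := List.mem_singleton.1 hC
      exact ⟨y, hy, hyx⟩

instance [Finite V] [Finite E] : Finite G.Subgraph :=
  Finite.of_injective (fun C : G.Subgraph => (C.verts, C.edges)) fun _ _ h =>
    Subgraph.ext (congrArg Prod.fst h) (congrArg Prod.snd h)

section MaximalLength

variable [Finite V] [Finite E]

theorem IsCycleChain.length_le (hl : IsCycleChain l) : l.length ≤ Nat.card G.Subgraph := by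
  have := Fintype.ofFinite G.Subgraph
  rw [Nat.card_eq_fintype_card]
  exact hl.2.1.length_le_card

theorem exists_isGreatest_length {P : List G.Subgraph → Prop} (hP : P []) :
    ∃ d, IsGreatest {k | ∃ l : List G.Subgraph, IsCycleChain l ∧ P l ∧ l.length = k} d := by
  have hbdd : BddAbove {k | ∃ l : List G.Subgraph, IsCycleChain l ∧ P l ∧ l.length = k} :=
    ⟨Nat.card G.Subgraph, by rintro _ ⟨l, hl, -, rfl⟩; exact hl.length_le⟩
  exact ⟨_, Nat.sSup_mem ⟨0, [], isCycleChain_nil, hP, rfl⟩ hbdd, fun _ hk => le_csSup hbdd hk⟩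

variable (G)

theorem exists_isMaxChainLength : ∃ d, G.IsMaxChainLength d := by
  simpa only [IsMaxChainLength, true_and] using
    exists_isGreatest_length (G := G) (P := fun _ => True) trivial

theorem exists_isMaxChainWithExitLength : ∃ d, G.IsMaxChainWithExitLength d :=
  exists_isGreatest_length (by simp [ChainHasExit])

end MaximalLength

section Rank

variable (G) in
/-- The maximal length of a chain of cycles from which `x` can be reached, for a finite graph. -/
noncomputable def rank (x : V) : ℕ :=
  sSup {k | ∃ l : List G.Subgraph, IsCycleChain l ∧ ChainReaches l x ∧ l.length = k}

variable [Finite V] [Finite E]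

variable (G) in
theorem isGreatest_rank (x : V) : IsGreatest
    {k | ∃ l : List G.Subgraph, IsCycleChain l ∧ ChainReaches l x ∧ l.length = k} (G.rank x) := by
  obtain ⟨d, hd⟩ := exists_isGreatest_length (G := G) (P := fun l => ChainReaches l x)
    (by simp [ChainReaches])
  rwa [rank, hd.csSup_eq]

theorem rank_mono (h : G.Reach x y) : G.rank x ≤ G.rank y := by
  obtain ⟨l, hl, hx, hlen⟩ := (isGreatest_rank G x).1
  refine hlen ▸ (isGreatest_rank G y).2 ⟨l, hl, fun C hC => ?_, rfl⟩
  obtain ⟨z, hz, hzx⟩ := hx C hC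
  exact ⟨z, hz, hzx.trans h⟩

theorem Subgraph.IsCycle.rank_pos (hC : C.IsCycle) (hx : x ∈ C.verts) : 0 < G.rank x := by
  refine (isGreatest_rank G x).2 ⟨[C], ?_, fun D hD => ?_, rfl⟩
  · exact isCycleChain_append_singleton_iff.2
      ⟨isCycleChain_nil, hC, List.not_mem_nil, by simp⟩
  · obtain rfl : C = D := by simpa using hD
    exact ⟨x, hx, .refl x⟩

theorem CyclesDisjoint.rank_lt (H : G.CyclesDisjoint) (hC : C.IsCycle) {e : E}
    (hr : G.r e ∈ C.verts) (he : e ∉ C.edges) : G.rank (G.s e) < G.rank (G.r e) := by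
  obtain ⟨l, hl, hx, hlen⟩ := (isGreatest_rank G (G.s e)).1
  have hCl : C ∉ l := fun h => by
    obtain ⟨y, hy, hye⟩ := hl.reach_of_mem hx h
    exact he (H.mem_edges hC hr ((hC.reach hr hy).trans hye))
  have hchain : IsCycleChain (l ++ [C]) := by
    refine isCycleChain_append_singleton_iff.2 ⟨hl, hC, hCl, fun D hD => ?_⟩
    obtain ⟨y, hy, hye⟩ := hx D hD
    exact ⟨y, hy, _, hr, hye.trans (reach_range e)⟩
  refine (isGreatest_rank G (G.r e)).2 ⟨l ++ [C], hchain, ?_, by rw [List.length_append, hlen]; rfl⟩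
  intro D hD
  obtain rfl : C = D := by simpa using hD
  exact ⟨_, hr, .refl _⟩

theorem exists_isCycle_not_hasExit_of_lt_rank {d : ℕ} (hd : G.IsMaxChainWithExitLength d)
    (hx : d < G.rank x) : ∃ C : G.Subgraph, C.IsCycle ∧ ¬ C.HasExit ∧ x ∈ C.verts := by
  obtain ⟨l, hl, hlx, hlen⟩ := (isGreatest_rank G x).1
  have hexit : ¬ ChainHasExit l := fun h => hx.not_ge (hlen ▸ hd.2 ⟨l, hl, h, rfl⟩)
  simp only [ChainHasExit, not_forall] at hexit
  obtain ⟨C, hC, hexit⟩ := hexit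
  obtain ⟨y, hy, hyx⟩ := hlx C hC
  exact ⟨C, hl.1 C (List.mem_of_getLast? hC), hexit, C.mem_verts_of_reach hexit hy hyx⟩

theorem rank_le {d : ℕ} (hd : G.IsMaxChainLength d) (x : V) : G.rank x ≤ d := by
  obtain ⟨l, hl, -, hlen⟩ := (isGreatest_rank G x).1
  exact hd.2 ⟨l, hl, hlen⟩

end Rank

end DirectedGraph

/-! ## Counting paths -/

namespace Growth

open Asymptotics Filter

theorem pow_isBigO_pow {j k : ℕ} (hjk : j ≤ k) :
    (fun n : ℕ => (n : ℝ) ^ j) =O[atTop] fun n : ℕ => (n : ℝ) ^ k := by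
  refine .of_bound 1 ?_
  filter_upwards [eventually_ge_atTop 1] with n hn
  rw [one_mul, Real.norm_of_nonneg (by positivity), Real.norm_of_nonneg (by positivity)]
  exact pow_le_pow_right₀ (Nat.one_le_cast.2 hn) hjk

theorem isBigO_of_natCast_le {a b : ℕ → ℕ} {g : ℕ → ℝ} (hab : ∀ n, a n ≤ b n)
    (hb : (fun n => (b n : ℝ)) =O[atTop] g) : (fun n => (a n : ℝ)) =O[atTop] g :=
  .trans (.of_norm_le fun n => by simpa using hab n) hb

theorem ncard_isBigO_of_subset_iUnion {ι α : Type*} [Finite ι] {A : ℕ → Set α}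
    {B : ι → ℕ → Set α} {g : ℕ → ℝ} (hA : ∀ n, A n ⊆ ⋃ i, B i n) (hfin : ∀ i n, (B i n).Finite)
    (hB : ∀ i, (fun n => ((B i n).ncard : ℝ)) =O[atTop] g) :
    (fun n => ((A n).ncard : ℝ)) =O[atTop] g := by
  have := Fintype.ofFinite ι
  refine isBigO_of_natCast_le (b := fun n => ∑ i, (B i n).ncard) (fun n => ?_) ?_
  · exact (Set.ncard_le_ncard (hA n) (Set.finite_iUnion fun i => hfin i n)).trans
      (Set.ncard_iUnion_le_of_fintype _)
  · simpa only [Nat.cast_sum] using IsBigO.fun_sum fun i _ => hB i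

end Growth

namespace DirectedGraph

open Asymptotics Filter Growth

variable {V : Type u} {E : Type v} {G : DirectedGraph V E} {C : G.Subgraph} {e : E} {S : Set E}
  {x : V} {k n : ℕ}

section PathsInto

variable (G) in
/-- The paths of length at most `n` with range `x` whose last edge, if any, is in `S`. The set `S`
serves to select the paths that arrive at a vertex of a cycle from outside. -/
def pathsInto (S : Set E) (x : V) (n : ℕ) : Set (List E) :=
  {p | G.IsPathTo p x ∧ p.length ≤ n ∧ ∀ e ∈ p.getLast?, e ∈ S}

theorem finite_pathsInto [Finite E] (S : Set E) (x : V) (n : ℕ) : (G.pathsInto S x n).Finite :=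
  (List.finite_length_le E n).subset fun _ hp => hp.2.1

theorem pathsInto_mono : Monotone (G.pathsInto S x) := fun _ _ hmn _ hp =>
  ⟨hp.1, hp.2.1.trans hmn, hp.2.2⟩

theorem ncard_pathsInto_mono [Finite E] : Monotone fun n => (G.pathsInto S x n).ncard :=
  fun _ n hmn => Set.ncard_le_ncard (pathsInto_mono hmn) (finite_pathsInto S x n)

theorem nil_mem_pathsInto : [] ∈ G.pathsInto S x n := ⟨isPathTo_nil, Nat.zero_le n, by simp⟩

theorem append_singleton_mem_pathsInto_iff {p : List E} : p ++ [e] ∈ G.pathsInto S x (n + 1) ↔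
    G.r e = x ∧ e ∈ S ∧ p ∈ G.pathsInto Set.univ (G.s e) n := by
  simp only [pathsInto, Set.mem_ofPred_eq, isPathTo_append_singleton_iff, List.length_append,
    List.length_singleton, List.getLast?_concat, Option.mem_some, Set.mem_univ]
  grind

theorem pathsInto_isBigO_of_source [Finite E]
    (h : ∀ e ∈ S, G.r e = x →
      (fun n => ((G.pathsInto Set.univ (G.s e) n).ncard : ℝ)) =O[atTop] fun n : ℕ => (n : ℝ) ^ k) :
    (fun n => ((G.pathsInto S x n).ncard : ℝ)) =O[atTop] fun n : ℕ => (n : ℝ) ^ k := by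
  let B : Option {e // e ∈ S ∧ G.r e = x} → ℕ → Set (List E)
    | none, _ => {[]}
    | some e, n => (· ++ [e.1]) '' G.pathsInto Set.univ (G.s e) n
  refine ncard_isBigO_of_subset_iUnion (B := B) (fun n p hp => Set.mem_iUnion.2 ?_) ?_ ?_
  · obtain rfl | ⟨p, e, rfl⟩ := p.eq_nil_or_concat'
    · exact ⟨none, rfl⟩
    · have hp' := append_singleton_mem_pathsInto_iff.1 (pathsInto_mono n.le_succ hp)
      exact ⟨some ⟨e, hp'.2.1, hp'.1⟩, p, hp'.2.2, rfl⟩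
  · rintro (_ | e) n
    exacts [Set.finite_singleton _, (finite_pathsInto _ _ n).image _]
  · rintro (_ | e)
    · simpa only [B, Set.ncard_singleton, Nat.cast_one, pow_zero] using
        pow_isBigO_pow (Nat.zero_le k)
    · simpa only [B, Set.ncard_image_of_injective _ (List.append_left_injective [e.1])] using
        h e.1 e.2.1 e.2.2

end PathsInto

namespace Subgraph.IsCycle

theorem exists_edge_to (hC : C.IsCycle) (hx : x ∈ C.verts) : ∃ e ∈ C.edges, G.r e = x := by
  obtain ⟨p, hp, hpx, -, rfl⟩ := hC.exists_isPath hx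
  obtain rfl | ⟨p, e, rfl⟩ := p.eq_nil_or_concat'
  · exact absurd rfl hp
  · exact ⟨e, by simp [subgraphOf], (isPathTo_append_singleton_iff.1 hpx.isPathTo).1⟩

theorem ncard_pathsInto_univ_le [Finite E] (hC : C.IsCycle) {B : ℕ → ℕ} (hB : Monotone B)
    (h : ∀ y ∈ C.verts, ∀ n, (G.pathsInto C.edgesᶜ y n).ncard ≤ B n) (hx : x ∈ C.verts) (n : ℕ) :
    (G.pathsInto Set.univ x n).ncard ≤ (n + 1) * B n := by
  induction n generalizing x with
  | zero =>
    have hzero : G.pathsInto Set.univ x 0 ⊆ G.pathsInto C.edgesᶜ x 0 := fun p hp => by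
      rw [List.length_eq_zero_iff.1 (Nat.le_zero.1 hp.2.1)]
      exact nil_mem_pathsInto
    simpa using (Set.ncard_le_ncard hzero (finite_pathsInto _ x 0)).trans (h x hx 0)
  | succ n ih =>
    obtain ⟨e, he, rfl⟩ := hC.exists_edge_to hx
    have hsub : G.pathsInto Set.univ (G.r e) (n + 1) ⊆ G.pathsInto C.edgesᶜ (G.r e) (n + 1) ∪
        (· ++ [e]) '' G.pathsInto Set.univ (G.s e) n := fun p hp => by
      obtain rfl | ⟨p, f, rfl⟩ := p.eq_nil_or_concat'
      · exact .inl nil_mem_pathsInto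
      obtain ⟨hf, -, hp'⟩ := append_singleton_mem_pathsInto_iff.1 hp
      by_cases hfC : f ∈ C.edges
      · obtain rfl := hC.r_injOn hfC he hf
        exact .inr ⟨p, hp', rfl⟩
      · exact .inl (append_singleton_mem_pathsInto_iff.2 ⟨hf, hfC, hp'⟩)
    calc (G.pathsInto Set.univ (G.r e) (n + 1)).ncard
        ≤ (G.pathsInto C.edgesᶜ (G.r e) (n + 1)).ncard +
          ((· ++ [e]) '' G.pathsInto Set.univ (G.s e) n).ncard :=
        (Set.ncard_le_ncard hsub ((finite_pathsInto _ _ _).union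
          ((finite_pathsInto _ _ _).image _))).trans (Set.ncard_union_le _ _)
      _ ≤ B (n + 1) + (n + 1) * B (n + 1) := by
        refine Nat.add_le_add (h _ hx _) ?_
        exact (Set.ncard_image_le (finite_pathsInto _ _ _)).trans
          ((ih (C.s_mem e he)).trans (Nat.mul_le_mul_left _ (hB n.le_succ)))
      _ = (n + 1 + 1) * B (n + 1) := by ring

theorem pathsInto_univ_isBigO [Finite V] [Finite E] (hC : C.IsCycle)
    (h : ∀ y ∈ C.verts, (fun n => ((G.pathsInto C.edgesᶜ y n).ncard : ℝ)) =O[atTop]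
      fun n : ℕ => (n : ℝ) ^ k) (hx : x ∈ C.verts) :
    (fun n => ((G.pathsInto Set.univ x n).ncard : ℝ)) =O[atTop] fun n : ℕ => (n : ℝ) ^ (k + 1) := by
  have := Fintype.ofFinite C.verts
  let B : ℕ → ℕ := fun n => ∑ y : C.verts, (G.pathsInto C.edgesᶜ y.1 n).ncard
  have hBO : (fun n => (B n : ℝ)) =O[atTop] fun n : ℕ => (n : ℝ) ^ k := by
    simpa only [B, Nat.cast_sum] using IsBigO.fun_sum fun (y : C.verts) _ => h y.1 y.2
  have hsucc : (fun n : ℕ => ((n + 1 : ℕ) : ℝ)) =O[atTop] fun n : ℕ => (n : ℝ) := by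
    simpa using (isBigO_refl (fun n : ℕ => (n : ℝ)) atTop).add
      (by simpa using pow_isBigO_pow zero_le_one)
  have hle (n : ℕ) : (G.pathsInto Set.univ x n).ncard ≤ (n + 1) * B n := by
    refine hC.ncard_pathsInto_univ_le ?_ (fun y hy n => ?_) hx n
    · exact fun _ _ hmn => Finset.sum_le_sum fun y _ => ncard_pathsInto_mono hmn
    · exact Finset.single_le_sum (f := fun y : C.verts => (G.pathsInto C.edgesᶜ y.1 n).ncard)
        (fun _ _ => Nat.zero_le _) (Finset.mem_univ ⟨y, hy⟩)
  refine isBigO_of_natCast_le hle ?_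
  simpa only [Nat.cast_mul, pow_succ'] using hsucc.mul hBO

end Subgraph.IsCycle

namespace CyclesDisjoint

variable [Finite V] [Finite E]

theorem pathsInto_univ_isBigO (H : G.CyclesDisjoint) (x : V) :
    (fun n => ((G.pathsInto Set.univ x n).ncard : ℝ)) =O[atTop]
      fun n : ℕ => (n : ℝ) ^ G.rank x := by
  induction x using (wellFounded_reach_and_not_reach G).induction with
  | _ x ih
  by_cases hx : ∃ C : G.Subgraph, C.IsCycle ∧ x ∈ C.verts
  case neg =>
    refine pathsInto_isBigO_of_source fun e _ hex => ?_
    subst hex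
    have hnot : ¬ G.Reach (G.r e) (G.s e) := fun h =>
      let ⟨C, hC, he⟩ := exists_isCycle_mem_edges h
      hx ⟨C, hC, C.r_mem e he⟩
    exact (ih _ ⟨reach_range e, hnot⟩).trans (pow_isBigO_pow (rank_mono (reach_range e)))
  obtain ⟨C, hC, hx⟩ := hx
  rw [← Nat.sub_add_cancel (hC.rank_pos hx)]
  refine hC.pathsInto_univ_isBigO (fun y hy => ?_) hx
  refine pathsInto_isBigO_of_source fun e he hey => ?_
  subst hey
  have hnot : ¬ G.Reach x (G.s e) := fun h => he (H.mem_edges hC hy ((hC.reach hy hx).trans h))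
  refine (ih _ ⟨(reach_range e).trans (hC.reach hy hx), hnot⟩).trans (pow_isBigO_pow ?_)
  exact Nat.le_sub_one_of_lt ((H.rank_lt hC hy he).trans_le (rank_mono (hC.reach hy hx)))

theorem pathsInto_compl_edges_isBigO (H : G.CyclesDisjoint) (hC : C.IsCycle) (hx : x ∈ C.verts) :
    (fun n => ((G.pathsInto C.edgesᶜ x n).ncard : ℝ)) =O[atTop]
      fun n : ℕ => (n : ℝ) ^ (G.rank x - 1) := by
  refine pathsInto_isBigO_of_source fun e he hex => ?_
  subst hex
  exact (H.pathsInto_univ_isBigO _).trans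
    (pow_isBigO_pow (Nat.le_sub_one_of_lt (H.rank_lt hC hx he)))

end CyclesDisjoint

end DirectedGraph

/-! ## Counting normal monomials -/

namespace DirectedGraph

open Asymptotics Filter Growth

variable {V : Type u} {E : Type v} {G : DirectedGraph V E} {C : G.Subgraph} {x : V}

section MonomialsAt

/-- The monomials `p x q*` with `p ∈ A` and `q ∈ B`. -/
def monomialsAt (x : V) (A B : Set (List E)) : Set (Monomial V E) :=
  (fun pq : List E × List E => ⟨pq.1, x, pq.2.reverse⟩) '' A ×ˢ B

variable {A B : Set (List E)}

theorem mem_monomialsAt_iff {m : Monomial V E} :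
    m ∈ monomialsAt x A B ↔ m.real ∈ A ∧ m.range = x ∧ m.ghost.reverse ∈ B := by
  constructor
  · rintro ⟨⟨p, q⟩, ⟨hp, hq⟩, rfl⟩
    exact ⟨hp, rfl, by rwa [List.reverse_reverse]⟩
  · rintro ⟨hp, rfl, hq⟩
    exact ⟨(m.real, m.ghost.reverse), ⟨hp, hq⟩, by simp only [List.reverse_reverse]⟩

theorem ncard_monomialsAt : (monomialsAt x A B).ncard = A.ncard * B.ncard := by
  rw [monomialsAt, Set.ncard_image_of_injective, Set.ncard_prod]
  rintro ⟨p, q⟩ ⟨p', q'⟩ h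
  simpa using h

theorem finite_monomialsAt (hA : A.Finite) (hB : B.Finite) : (monomialsAt x A B).Finite :=
  (hA.prod hB).image _

theorem ncard_monomialsAt_isBigO {A B : ℕ → Set (List E)} {i j : ℕ}
    (hA : (fun n => ((A n).ncard : ℝ)) =O[atTop] fun n : ℕ => (n : ℝ) ^ i)
    (hB : (fun n => ((B n).ncard : ℝ)) =O[atTop] fun n : ℕ => (n : ℝ) ^ j) :
    (fun n => ((monomialsAt x (A n) (B n)).ncard : ℝ)) =O[atTop]
      fun n : ℕ => (n : ℝ) ^ (i + j) := by
  simpa only [ncard_monomialsAt, Nat.cast_mul, pow_add] using hA.mul hB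

end MonomialsAt

variable {m : Monomial V E} {n : ℕ}

theorem mem_monomialsAt_of_mem_normalMonomials (hm : m ∈ G.normalMonomials n) :
    m ∈ monomialsAt m.range (G.pathsInto Set.univ m.range n)
      (G.pathsInto Set.univ m.range n) := by
  have hlen : m.real.length + m.ghost.length ≤ n := hm.2
  refine mem_monomialsAt_iff.2 ⟨⟨hm.1.real, by omega, fun _ _ => trivial⟩, rfl,
    ⟨hm.1.ghost, ?_, fun _ _ => trivial⟩⟩
  rw [List.length_reverse]
  omega

theorem Subgraph.IsCycle.real_or_ghost_mem_pathsInto [Finite E] (hC : C.IsCycle)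
    (hexit : ¬ C.HasExit) (hm : m ∈ G.normalMonomials n) :
    m.real ∈ G.pathsInto C.edgesᶜ m.range n ∨
      m.ghost.reverse ∈ G.pathsInto C.edgesᶜ m.range n := by
  obtain ⟨hreal, -, hghost⟩ := mem_monomialsAt_iff.1 (mem_monomialsAt_of_mem_normalMonomials hm)
  by_contra! h
  obtain ⟨hnreal, hnghost⟩ := h
  have hlast {p : List E} (hp : p ∈ G.pathsInto Set.univ m.range n)
      (hpC : p ∉ G.pathsInto C.edgesᶜ m.range n) :
      ∃ e ∈ C.edges, G.r e = m.range ∧ p.getLast? = some e := by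
    obtain rfl | ⟨p, e, rfl⟩ := p.eq_nil_or_concat'
    · exact absurd nil_mem_pathsInto hpC
    · refine ⟨e, ?_, (isPathTo_append_singleton_iff.1 hp.1).1, List.getLast?_concat⟩
      by_contra he
      exact hpC ⟨hp.1, hp.2.1, by simpa using he⟩
  obtain ⟨e, he, her, hereal⟩ := hlast hreal hnreal
  obtain ⟨f, hf, hfr, hfghost⟩ := hlast hghost hnghost
  obtain rfl := hC.r_injOn he hf (her.trans hfr.symm)
  rw [List.getLast?_reverse] at hfghost
  exact hm.1.not_isSpecial e hereal hfghost (hC.isSpecial_of_not_hasExit hexit he)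

namespace CyclesDisjoint

variable [Finite V] [Finite E]

theorem normalMonomials_range_isBigO (H : G.CyclesDisjoint) (x : V) :
    (fun n => ({m ∈ G.normalMonomials n | m.range = x}.ncard : ℝ)) =O[atTop]
      fun n : ℕ => (n : ℝ) ^ (2 * G.rank x) := by
  rw [two_mul]
  refine isBigO_of_natCast_le (fun n => Set.ncard_le_ncard ?_ ?_)
    (ncard_monomialsAt_isBigO (x := x) (H.pathsInto_univ_isBigO x) (H.pathsInto_univ_isBigO x))
  · rintro m ⟨hm, rfl⟩
    exact mem_monomialsAt_of_mem_normalMonomials hm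
  · exact finite_monomialsAt (finite_pathsInto _ x n) (finite_pathsInto _ x n)

theorem normalMonomials_range_isBigO_of_not_hasExit (H : G.CyclesDisjoint) (hC : C.IsCycle)
    (hexit : ¬ C.HasExit) (hx : x ∈ C.verts) :
    (fun n => ({m ∈ G.normalMonomials n | m.range = x}.ncard : ℝ)) =O[atTop]
      fun n : ℕ => (n : ℝ) ^ (2 * G.rank x - 1) := by
  let P (n : ℕ) := G.pathsInto Set.univ x n
  let P' (n : ℕ) := G.pathsInto C.edgesᶜ x n
  have hP := H.pathsInto_univ_isBigO x
  have hP' := H.pathsInto_compl_edges_isBigO hC hx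
  have hrank := hC.rank_pos hx
  let B : Bool → ℕ → Set (Monomial V E)
    | false, n => monomialsAt x (P' n) (P n)
    | true, n => monomialsAt x (P n) (P' n)
  refine ncard_isBigO_of_subset_iUnion (B := B) ?_ ?_ ?_
  · rintro n m ⟨hm, rfl⟩
    obtain ⟨hreal, -, hghost⟩ := mem_monomialsAt_iff.1 (mem_monomialsAt_of_mem_normalMonomials hm)
    obtain h | h := hC.real_or_ghost_mem_pathsInto hexit hm
    · exact Set.mem_iUnion.2 ⟨false, mem_monomialsAt_iff.2 ⟨h, rfl, hghost⟩⟩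
    · exact Set.mem_iUnion.2 ⟨true, mem_monomialsAt_iff.2 ⟨hreal, rfl, h⟩⟩
  · rintro (_ | _) n <;> exact finite_monomialsAt (finite_pathsInto _ x n) (finite_pathsInto _ x n)
  · rintro (_ | _)
    · exact (ncard_monomialsAt_isBigO hP' hP).trans (pow_isBigO_pow (by omega))
    · exact (ncard_monomialsAt_isBigO hP hP').trans (pow_isBigO_pow (by omega))

theorem normalMonomials_isBigO (H : G.CyclesDisjoint) {d₁ d₂ : ℕ} (h₁ : G.IsMaxChainLength d₁)
    (h₂ : G.IsMaxChainWithExitLength d₂) :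
    (fun n => ((G.normalMonomials n).ncard : ℝ)) =O[atTop]
      fun n : ℕ => (n : ℝ) ^ max (2 * d₁ - 1) (2 * d₂) := by
  refine ncard_isBigO_of_subset_iUnion (B := fun x n => {m ∈ G.normalMonomials n | m.range = x})
    (fun n m hm => Set.mem_iUnion.2 ⟨m.range, hm, rfl⟩)
    (fun x n => (G.finite_normalMonomials n).subset (Set.sep_subset _ _)) fun x => ?_
  have hrank := rank_le h₁ x
  by_cases hx : G.rank x ≤ d₂
  · exact (H.normalMonomials_range_isBigO x).trans (pow_isBigO_pow (by omega))
  · obtain ⟨C, hC, hexit, hxC⟩ := exists_isCycle_not_hasExit_of_lt_rank h₂ (not_le.1 hx)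
    exact (H.normalMonomials_range_isBigO_of_not_hasExit hC hexit hxC).trans
      (pow_isBigO_pow (by omega))

end CyclesDisjoint

end DirectedGraph

/-! ## Lower bounds -/

namespace Growth

theorem asympLE_ncard_of_mapsTo {α β : Type*} {A : ℕ → Set α} {B : ℕ → Set β} {f : α → β} {c : ℕ}
    (hc : 0 < c) (hB : ∀ n, (B n).Finite) (hinj : ∀ n, Set.InjOn f (A n))
    (hmaps : ∀ n, 0 < n → Set.MapsTo f (A n) (B (c * n))) :
    AsympLE (fun n => (A n).ncard) fun n => (B n).ncard :=
  asympLE_of_le_comp_mul (fun _ => Nat.cast_nonneg _) hc fun n hn =>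
    Nat.cast_le.2 (Set.ncard_le_ncard_of_injOn f (hmaps n hn) (hinj n) (hB _))

theorem AsympLE.natCast_pow_add {a b : ℕ → ℕ} {i j : ℕ} (ha : AsympLE (fun n => (n : ℝ) ^ i) (a ·))
    (hb : AsympLE (fun n => (n : ℝ) ^ j) (b ·)) (hmonoa : Monotone a) (hmonob : Monotone b) :
    AsympLE (fun n => (n : ℝ) ^ (i + j)) fun n => ((a n * b n : ℕ) : ℝ) := by
  have hmul := ha.mul hb (fun n => by positivity) (fun n => Nat.cast_nonneg _)
    (Nat.mono_cast.comp hmonoa) (Nat.mono_cast.comp hmonob)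
  simpa only [pow_add, Nat.cast_mul, Pi.mul_def] using hmul

theorem pow_zero_asympLE_ncard {α : Type*} {B : ℕ → Set α} (hB : ∀ n, (B n).Finite)
    (hne : ∀ n, (B n).Nonempty) : AsympLE (fun n => (n : ℝ) ^ 0) fun n => (B n).ncard := by
  refine ⟨1, one_pos, fun n _ => ?_⟩
  have hpos : 1 ≤ (B (1 * n)).ncard := (Set.ncard_pos (hB _)).2 (hne _)
  simpa only [pow_zero, Nat.cast_one, one_mul, Nat.one_le_cast] using hpos

theorem ncard_setOf_length_eq {α : Type*} [Finite α] (n : ℕ) :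
    {l : List α | l.length = n}.ncard = Nat.card α ^ n := by
  have := Fintype.ofFinite α
  rw [← Nat.card_coe_set_eq, Nat.card_eq_fintype_card (α := α), ← card_vector n]
  exact Nat.card_eq_fintype_card (α := List.Vector α n)

theorem injOn_flatMap {α β : Type*} {f : α → List β} {m : ℕ} (hf : Function.Injective f)
    (hlen : ∀ a, (f a).length = m) (n : ℕ) : Set.InjOn (List.flatMap f) {l | l.length = n} := by
  intro l hl l' hl' h
  induction n generalizing l l' with
  | zero => rw [List.length_eq_zero_iff.1 hl, List.length_eq_zero_iff.1 hl']
  | succ n ih =>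
    obtain ⟨a, l, rfl⟩ := List.exists_cons_of_length_eq_add_one hl
    obtain ⟨a', l', rfl⟩ := List.exists_cons_of_length_eq_add_one hl'
    rw [List.flatMap_cons, List.flatMap_cons] at h
    obtain ⟨ha, hl''⟩ := List.append_inj h ((hlen a).trans (hlen a').symm)
    rw [hf ha, ih (Nat.succ.inj hl) (Nat.succ.inj hl') hl'']

end Growth

namespace DirectedGraph

open Growth

variable {V : Type u} {E : Type v} {G : DirectedGraph V E} {C D : G.Subgraph} {e : E} {S T : Set E}
  {p q c : List E} {x y : V} {k : ℕ}

section PathsInto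

variable [Finite E]

theorem Reach.pathsInto_univ_asympLE (h : G.Reach x y) :
    AsympLE (fun n => (G.pathsInto Set.univ x n).ncard)
      fun n => (G.pathsInto Set.univ y n).ncard := by
  obtain ⟨p, hp⟩ := h
  refine asympLE_ncard_of_mapsTo (f := (· ++ p)) p.length.succ_pos (finite_pathsInto _ y)
    (fun n => (List.append_left_injective p).injOn) fun n hn q hq => ?_
  refine ⟨hq.1.append hp, ?_, fun _ _ => trivial⟩
  rw [List.length_append]
  nlinarith [hq.2.1]

theorem pathsInto_univ_source_asympLE (he : e ∈ S) :
    AsympLE (fun n => (G.pathsInto Set.univ (G.s e) n).ncard)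
      fun n => (G.pathsInto S (G.r e) n).ncard := by
  refine asympLE_ncard_of_mapsTo (f := (· ++ [e])) two_pos (finite_pathsInto S _)
    (fun n => (List.append_left_injective [e]).injOn) fun n hn q hq => ?_
  exact pathsInto_mono (by omega) (append_singleton_mem_pathsInto_iff.2 ⟨rfl, he, hq⟩)

end PathsInto

section Powers

theorem IsPath.flatten_replicate (hc : G.IsPath x c x) (a : ℕ) :
    G.IsPath x (List.replicate a c).flatten x := by
  induction a with
  | zero => exact .nil x
  | succ a ih => exact hc.append ih

theorem eq_of_append_flatten_replicate_eq {a b : ℕ} (hc : ∃ e ∈ c.getLast?, e ∉ S)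
    (hp : ∀ e ∈ p.getLast?, e ∈ S) (hq : ∀ e ∈ q.getLast?, e ∈ S)
    (h : p ++ (List.replicate a c).flatten = q ++ (List.replicate b c).flatten) :
    p = q ∧ a = b := by
  obtain ⟨e, hec, heS⟩ := hc
  have hlast (r : List E) : (r ++ c).getLast? = some e := by
    rw [List.getLast?_append, Option.mem_def.1 hec]
    rfl
  induction a generalizing b with
  | zero =>
    cases b with
    | zero => simpa using h
    | succ b =>
      rw [List.replicate_succ', List.flatten_concat, ← List.append_assoc, List.replicate_zero,
        List.flatten_nil, List.append_nil] at h
      exact absurd (hp e (h ▸ hlast _)) heS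
  | succ a ih =>
    rw [List.replicate_succ', List.flatten_concat, ← List.append_assoc] at h
    cases b with
    | zero =>
      rw [List.replicate_zero, List.flatten_nil, List.append_nil] at h
      exact absurd (hq e (h ▸ hlast _)) heS
    | succ b =>
      rw [List.replicate_succ', List.flatten_concat, ← List.append_assoc] at h
      obtain ⟨hpq, hab⟩ := ih (List.append_cancel_right h)
      exact ⟨hpq, congrArg Nat.succ hab⟩

theorem Subgraph.IsCycle.pow_succ_asympLE_pathsInto_univ [Finite E] (hC : C.IsCycle)
    (hx : x ∈ C.verts)
    (h : AsympLE (fun n => (n : ℝ) ^ k) fun n => (G.pathsInto C.edgesᶜ x n).ncard) :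
    AsympLE (fun n => (n : ℝ) ^ (k + 1)) fun n => (G.pathsInto Set.univ x n).ncard := by
  obtain ⟨c, hc, hcx, -, hCc⟩ := hC.exists_isPath hx
  have hlast : ∃ e ∈ c.getLast?, e ∉ C.edgesᶜ :=
    ⟨c.getLast hc, List.getLast?_eq_some_getLast hc,
      not_not.2 (by rw [hCc]; exact List.getLast_mem hc)⟩
  have hlin : AsympLE (fun n => (n : ℝ) ^ 1) fun n => ((n + 1 : ℕ) : ℝ) :=
    ⟨1, one_pos, fun n _ => by simp⟩
  have hpow := h.natCast_pow_add hlin ncard_pathsInto_mono fun _ _ => Nat.succ_le_succ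
  have hprod (n : ℕ) : (G.pathsInto C.edgesᶜ x n).ncard * (n + 1) =
      (G.pathsInto C.edgesᶜ x n ×ˢ Set.Iic n).ncard := by
    rw [Set.ncard_prod, ← Finset.coe_Iic, Set.ncard_coe_finset, Nat.card_Iic]
  simp only [hprod] at hpow
  refine hpow.trans (asympLE_ncard_of_mapsTo (c := c.length + 1)
    (f := fun qa => qa.1 ++ (List.replicate qa.2 c).flatten)
    (Nat.succ_pos _) (finite_pathsInto _ x) ?_ ?_)
  · rintro n ⟨q, a⟩ ⟨hq, -⟩ ⟨q', a'⟩ ⟨hq', -⟩ heq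
    exact Prod.ext_iff.2 (eq_of_append_flatten_replicate_eq hlast hq.2.2 hq'.2.2 heq)
  · rintro n - ⟨q, a⟩ ⟨hq, ha⟩
    refine ⟨hq.1.append (hcx.flatten_replicate a), ?_, fun _ _ => trivial⟩
    have ha : a ≤ n := ha
    have hlen : q.length ≤ n := hq.2.1
    simp only [List.length_append, List.length_flatten, List.map_replicate, List.sum_replicate,
      smul_eq_mul]
    nlinarith

end Powers

section Chains

theorem Subgraph.IsCycle.verts_nonempty (hC : C.IsCycle) : C.verts.Nonempty := by
  obtain ⟨p, ⟨hp, -, -⟩, rfl⟩ := hC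
  obtain ⟨e, he⟩ := List.exists_mem_of_ne_nil p hp
  exact ⟨G.s e, e, he, .inl rfl⟩

variable [Finite E]

theorem CyclesDisjoint.exists_pow_asympLE_pathsInto (H : G.CyclesDisjoint) {l : List G.Subgraph}
    (hl : IsCycleChain (l ++ [C])) : ∃ x ∈ C.verts,
      AsympLE (fun n => (n : ℝ) ^ l.length) fun n => (G.pathsInto C.edgesᶜ x n).ncard := by
  induction l using List.reverseRecOn generalizing C with
  | nil =>
    obtain ⟨x, hx⟩ := hl.1 C (by simp) |>.verts_nonempty
    exact ⟨x, hx, pow_zero_asympLE_ncard (finite_pathsInto _ x) fun n => ⟨[], nil_mem_pathsInto⟩⟩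
  | append_singleton l D ih =>
    obtain ⟨hl, hC, hCl, hlast⟩ := isCycleChain_append_singleton_iff.1 hl
    obtain ⟨-, hD, -⟩ := isCycleChain_append_singleton_iff.1 hl
    obtain ⟨x, hx, hpow⟩ := ih hl
    obtain ⟨a, ha, b, hb, hab⟩ := hlast D (by simp)
    obtain ⟨p, hp⟩ := (hD.reach hx ha).trans hab
    have hDC : D ≠ C := fun h => hCl (by simp [h])
    obtain ⟨e, hxe, hes, her⟩ :=
      hp.exists_edge_into (Set.disjoint_left.1 (H D C hD hC hDC) hx) hb
    refine ⟨G.r e, her, ?_⟩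
    rw [List.length_append, List.length_singleton]
    exact ((hD.pow_succ_asympLE_pathsInto_univ hx hpow).trans hxe.pathsInto_univ_asympLE).trans
      (pathsInto_univ_source_asympLE fun he => hes (C.s_mem e he))

theorem CyclesDisjoint.pow_asympLE_pathsInto_univ (H : G.CyclesDisjoint) {l : List G.Subgraph}
    (hl : IsCycleChain (l ++ [C])) (hx : x ∈ C.verts) :
    AsympLE (fun n => (n : ℝ) ^ (l.length + 1)) fun n => (G.pathsInto Set.univ x n).ncard := by
  have hC : C.IsCycle := hl.1 C (by simp)
  obtain ⟨y, hy, hpow⟩ := H.exists_pow_asympLE_pathsInto hl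
  exact (hC.pow_succ_asympLE_pathsInto_univ hy hpow).trans (hC.reach hy hx).pathsInto_univ_asympLE

end Chains

section NormalMonomials

theorem monomialsAt_subset_normalMonomials (h : ∀ e ∈ S, e ∈ T → ¬ G.IsSpecial e) (n : ℕ) :
    monomialsAt x (G.pathsInto S x n) (G.pathsInto T x n) ⊆ G.normalMonomials (2 * n) := by
  rintro _ ⟨⟨p, q⟩, ⟨hp, hq⟩, rfl⟩
  have hplen : p.length ≤ n := hp.2.1
  have hqlen : q.length ≤ n := hq.2.1
  refine ⟨⟨hp.1, (List.reverse_reverse q).symm ▸ hq.1, fun e hep heq => ?_⟩, ?_⟩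
  · rw [List.head?_reverse] at heq
    exact h e (hp.2.2 e hep) (hq.2.2 e heq)
  · grind [Monomial.length]

variable [Finite V] [Finite E]

theorem pow_add_asympLE_normalMonomials {i j : ℕ} (h : ∀ e ∈ S, e ∈ T → ¬ G.IsSpecial e)
    (hi : AsympLE (fun n => (n : ℝ) ^ i) fun n => (G.pathsInto S x n).ncard)
    (hj : AsympLE (fun n => (n : ℝ) ^ j) fun n => (G.pathsInto T x n).ncard) :
    AsympLE (fun n => (n : ℝ) ^ (i + j)) fun n => (G.normalMonomials n).ncard := by
  have hpow := hi.natCast_pow_add hj ncard_pathsInto_mono ncard_pathsInto_mono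
  simp only [← ncard_monomialsAt (x := x)] at hpow
  exact hpow.trans (asympLE_ncard_of_mapsTo (f := id) two_pos G.finite_normalMonomials
    (fun _ => Set.injOn_id _) fun n _ => monomialsAt_subset_normalMonomials h n)

variable [Nonempty V]

variable (G) in
theorem pow_zero_asympLE_normalMonomials :
    AsympLE (fun n => (n : ℝ) ^ 0) fun n => (G.normalMonomials n).ncard := by
  refine pow_zero_asympLE_ncard G.finite_normalMonomials fun n => ?_
  exact ⟨⟨[], Classical.arbitrary V, []⟩, isNormal_nil_iff.2 isPathTo_nil, Nat.zero_le n⟩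

namespace CyclesDisjoint

theorem pow_asympLE_normalMonomials_of_isMaxChainLength (H : G.CyclesDisjoint) {d : ℕ}
    (hd : G.IsMaxChainLength d) :
    AsympLE (fun n => (n : ℝ) ^ (2 * d - 1)) fun n => (G.normalMonomials n).ncard := by
  obtain ⟨l, hl, rfl⟩ := hd.1
  obtain rfl | ⟨l, C, rfl⟩ := l.eq_nil_or_concat'
  · exact G.pow_zero_asympLE_normalMonomials
  have hC : C.IsCycle := hl.1 C (by simp)
  obtain ⟨x, hx, hghost⟩ := H.exists_pow_asympLE_pathsInto hl
  obtain ⟨e, he, rfl⟩ := hC.exists_edge_to hx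
  have hreal := (H.pow_asympLE_pathsInto_univ hl (C.s_mem e he)).trans
    (pathsInto_univ_source_asympLE he)
  have hdeg : 2 * (l ++ [C]).length - 1 = l.length + 1 + l.length := by
    rw [List.length_append, List.length_singleton]
    omega
  rw [hdeg]
  exact pow_add_asympLE_normalMonomials (fun f hf hf' => absurd hf hf') hreal hghost

theorem pow_asympLE_normalMonomials_of_isMaxChainWithExitLength (H : G.CyclesDisjoint) {d : ℕ}
    (hd : G.IsMaxChainWithExitLength d) :
    AsympLE (fun n => (n : ℝ) ^ (2 * d)) fun n => (G.normalMonomials n).ncard := by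
  obtain ⟨l, hl, hexit, rfl⟩ := hd.1
  obtain rfl | ⟨l, C, rfl⟩ := l.eq_nil_or_concat'
  · exact G.pow_zero_asympLE_normalMonomials
  have hC : C.IsCycle := hl.1 C (by simp)
  obtain ⟨e, he, hspecial⟩ := hC.exists_not_isSpecial_of_hasExit (hexit C (by simp))
  have hpow := (H.pow_asympLE_pathsInto_univ hl he).trans
    (pathsInto_univ_source_asympLE (Set.mem_singleton e))
  rw [two_mul, List.length_append, List.length_singleton]
  refine pow_add_asympLE_normalMonomials (fun f hf _ => ?_) hpow hpow
  rwa [Set.mem_singleton_iff.1 hf]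

theorem pow_asympLE_normalMonomials (H : G.CyclesDisjoint) {d₁ d₂ : ℕ}
    (h₁ : G.IsMaxChainLength d₁) (h₂ : G.IsMaxChainWithExitLength d₂) :
    AsympLE (fun n => (n : ℝ) ^ max (2 * d₁ - 1) (2 * d₂))
      fun n => (G.normalMonomials n).ncard := by
  obtain h | h := max_choice (2 * d₁ - 1) (2 * d₂) <;> rw [h]
  exacts [H.pow_asympLE_normalMonomials_of_isMaxChainLength h₁,
    H.pow_asympLE_normalMonomials_of_isMaxChainWithExitLength h₂]

end CyclesDisjoint

end NormalMonomials

section ExponentialGrowth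

theorem IsPath.eq_of_prefix (hp : G.IsPath x p x) (hp₀ : p ≠ []) (hq : G.IsPath x q x)
    (hnd : (q.map G.s).Nodup) (h : p <+: q) : p = q := by
  obtain ⟨r, rfl⟩ := h
  obtain ⟨y, hpy, hr⟩ := isPath_append_iff.1 hq
  obtain rfl := hp.range_unique hpy
  cases r with
  | nil => rw [List.append_nil]
  | cons f r =>
    cases p with
    | nil => exact absurd rfl hp₀
    | cons e p =>
      have hef : G.s e = G.s f := (isPath_cons_iff.1 hp).1.trans (isPath_cons_iff.1 hr).1.symm
      simp [hef] at hnd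

theorem Subgraph.IsCycle.exists_isPath_append_ne (hC : C.IsCycle) (hD : D.IsCycle) (hCD : C ≠ D)
    (hxC : x ∈ C.verts) (hxD : x ∈ D.verts) :
    ∃ p q, G.IsPath x p x ∧ G.IsPath x q x ∧ p ++ q ≠ q ++ p := by
  obtain ⟨p, hp₀, hp, hpnd, rfl⟩ := hC.exists_isPath hxC
  obtain ⟨q, hq₀, hq, hqnd, rfl⟩ := hD.exists_isPath hxD
  refine ⟨p, q, hp, hq, fun h => hCD (congrArg G.subgraphOf ?_)⟩
  obtain hpq | hqp :=
    List.prefix_or_prefix_of_prefix (List.prefix_append p q) (h ▸ List.prefix_append q p)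
  · exact hp.eq_of_prefix hp₀ hq hqnd hpq
  · exact (hq.eq_of_prefix hq₀ hp hpnd hqp).symm

theorem two_pow_asympLE_normalMonomials [Finite V] [Finite E] (H : ¬ G.CyclesDisjoint) :
    AsympLE (fun n => 2 ^ n) fun n => (G.normalMonomials n).ncard := by
  simp only [CyclesDisjoint, not_forall, Set.not_disjoint_iff] at H
  obtain ⟨C, D, hC, hD, hCD, x, hxC, hxD⟩ := H
  obtain ⟨p, q, hp, hq, hpq⟩ := hC.exists_isPath_append_ne hD hCD hxC hxD
  let block (b : Bool) : List E := bif b then p ++ q else q ++ p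
  have hblock (b : Bool) : G.IsPath x (block b) x := by
    cases b
    exacts [hq.append hp, hp.append hq]
  have hlen (b : Bool) : (block b).length = p.length + q.length := by
    cases b <;> simp [block, Nat.add_comm]
  have hinj : Function.Injective block := Bool.injective_iff.2 hpq.symm
  have hword (l : List Bool) : G.IsPath x (l.flatMap block) x := by
    induction l with
    | nil => exact .nil x
    | cons b l ih => exact (hblock b).append ih
  have hpow (n : ℕ) : (2 : ℝ) ^ n = ({l : List Bool | l.length = n}.ncard : ℝ) := by
    rw [ncard_setOf_length_eq, Nat.card_eq_fintype_card, Fintype.card_bool]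
    norm_cast
  simp only [hpow]
  refine asympLE_ncard_of_mapsTo (f := fun l => ⟨l.flatMap block, x, []⟩)
    (p.length + q.length).succ_pos G.finite_normalMonomials (fun n l hl l' hl' h => ?_) ?_
  · exact injOn_flatMap hinj hlen n hl hl' (congrArg Monomial.real h)
  · rintro n - l rfl
    refine ⟨⟨(hword l).isPathTo, isPathTo_nil, by simp⟩, ?_⟩
    simp only [Monomial.length, List.length_flatMap, hlen, List.map_const', List.sum_replicate,
      smul_eq_mul, List.length_nil]
    nlinarith

end ExponentialGrowth

end DirectedGraph

/-! ## The Gelfand–Kirillov dimension -/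

namespace LeavittPathAlgebra

open DirectedGraph Growth Filter Asymptotics

variable {K : Type w} [Field K] {V : Type u} {E : Type v} [Finite V] [Finite E]
  {G : DirectedGraph V E} {W : Submodule K (LeavittPathAlgebra K G)}

theorem normalMonomials_asympLE_growthFun (hW : IsGeneratingSpace W) :
    AsympLE (fun n => (G.normalMonomials n).ncard) fun n => growthFun W n := by
  have := (isGeneratingSpace_genSpace K G).1
  refine .trans ⟨1, one_pos, fun n hn => ?_⟩ (growthFun_asympLE_growthFun (W' := genSpace K G) hW)
  simp only [Nat.cast_one, one_mul, growthFun_genSpace hn.ne', le_refl]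

theorem growthFun_asympLE_normalMonomials [FiniteDimensional K W] :
    AsympLE (fun n => growthFun W n) fun n => (G.normalMonomials n).ncard := by
  refine (growthFun_asympLE_growthFun (isGeneratingSpace_genSpace K G)).trans
    ⟨1, one_pos, fun n hn => ?_⟩
  simp only [Nat.cast_one, one_mul, growthFun_genSpace hn.ne', le_refl]

theorem cyclesDisjoint_of_hasPolynomialGrowth (hW : IsGeneratingSpace W)
    (h : HasPolynomialGrowth W) : G.CyclesDisjoint := by
  by_contra H
  obtain ⟨m, -, hm⟩ := h
  exact not_two_pow_asympLE_pow
    (((two_pow_asympLE_normalMonomials H).trans (normalMonomials_asympLE_growthFun hW)).trans hm)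

variable {d₁ d₂ : ℕ}

theorem growthFun_isBigO [FiniteDimensional K W] (H : G.CyclesDisjoint) (h₁ : G.IsMaxChainLength d₁)
    (h₂ : G.IsMaxChainWithExitLength d₂) : (fun n => (growthFun W n : ℝ)) =O[atTop]
      fun n : ℕ => (n : ℝ) ^ max (2 * d₁ - 1) (2 * d₂) := by
  have hmonomials := (asympLE_pow_iff_isBigO fun n => Nat.cast_nonneg _).2
    (H.normalMonomials_isBigO h₁ h₂)
  exact (asympLE_pow_iff_isBigO fun n => Nat.cast_nonneg _).1
    (growthFun_asympLE_normalMonomials.trans hmonomials)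

theorem gkDim_eq [Nonempty V] (hW : IsGeneratingSpace W) (H : G.CyclesDisjoint)
    (h₁ : G.IsMaxChainLength d₁) (h₂ : G.IsMaxChainWithExitLength d₂) :
    gkDim W = ((max (2 * (d₁ : ℝ) - 1) (2 * (d₂ : ℝ)) : ℝ) : EReal) := by
  -- At `d₁ = 0` the truncated `2 * d₁ - 1` is not the real one, but both are at most `2 * d₂`.
  have hcast : ((max (2 * d₁ - 1) (2 * d₂) : ℕ) : ℝ) = max (2 * (d₁ : ℝ) - 1) (2 * d₂) := by
    obtain _ | d₁ := d₁
    · rw [max_eq_right (by omega), max_eq_right (by push_cast; linarith), Nat.cast_mul,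
        Nat.cast_two]
    · rw [Nat.cast_max, Nat.cast_sub (by omega), Nat.cast_mul, Nat.cast_mul, Nat.cast_two,
        Nat.cast_one]
  have := hW.1
  rw [← hcast]
  exact gkDim_eq_of_isBigO_of_asympLE (growthFun_isBigO H h₁ h₂)
    ((H.pow_asympLE_normalMonomials h₁ h₂).trans (normalMonomials_asympLE_growthFun hW))

end LeavittPathAlgebra

theorem mainTheorem3 {K : Type*} [Field K] {V E : Type*}
    [Finite V] [Nonempty V] [Finite E] (G : DirectedGraph V E) :
    -- growth and dimension are defined: finite-dimensional generating spaces exist,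
    (∃ W : Submodule K (LeavittPathAlgebra K G), Growth.IsGeneratingSpace W) ∧
    -- and so do the two maximal lengths;
    ∃ d₁ d₂ : ℕ, G.IsMaxChainLength d₁ ∧ G.IsMaxChainWithExitLength d₂ ∧
      -- growth and dimension may be computed on any generating space
      ∀ W : Submodule K (LeavittPathAlgebra K G), Growth.IsGeneratingSpace W →
        (Growth.HasPolynomialGrowth W ↔
          ∀ C D : G.Subgraph, C.IsCycle → D.IsCycle → C ≠ D → Disjoint C.verts D.verts) ∧
        (Growth.HasPolynomialGrowth W →
          Growth.gkDim W = ((max (2 * (d₁ : ℝ) - 1) (2 * (d₂ : ℝ)) : ℝ) : EReal)) := by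
  refine ⟨⟨_, LeavittPathAlgebra.isGeneratingSpace_genSpace K G⟩, ?_⟩
  obtain ⟨d₁, h₁⟩ := G.exists_isMaxChainLength
  obtain ⟨d₂, h₂⟩ := G.exists_isMaxChainWithExitLength
  refine ⟨d₁, d₂, h₁, h₂, fun W hW => ?_⟩
  have := hW.1
  have hdisjoint : Growth.HasPolynomialGrowth W → G.CyclesDisjoint :=
    LeavittPathAlgebra.cyclesDisjoint_of_hasPolynomialGrowth hW
  have hgrowth (H : G.CyclesDisjoint) : Growth.HasPolynomialGrowth W :=
    Growth.hasPolynomialGrowth_of_isBigO (LeavittPathAlgebra.growthFun_isBigO H h₁ h₂)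
  exact ⟨⟨hdisjoint, hgrowth⟩, fun h => LeavittPathAlgebra.gkDim_eq hW (hdisjoint h) h₁ h₂⟩
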